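/- Let $Q$ be a finite bipartite quiver with vertex set $I=I_0\sqcup I_1$ and arrow set $\Omega$, where every arrow $h\in\Omega$ goes from a vertex $s(h)\in I_1$ to a vertex $t(h)\in I_0$. Fix vectors of nonnegative integers $w=(w_i,w'_i)_{i\in I}$ and $v=(v_i)_{i\in I}$, and put $W_i=\mathbb{C}^{w_i}$, $W'_i=\mathbb{C}^{w'_i}$. Let $$\mathbf{E}_w=\bigoplus_{\alpha\in I_0}\mathrm{Hom}(W'_\alpha,W_\alpha)\oplus\bigoplus_{\beta\in I_1}\mathrm{Hom}(W_\beta,W'_\beta)\oplus\bigoplus_{h\in\Omega}\mathrm{Hom}(W_{s(h)},W_{t(h)}),$$ with elements $(x_i,y_h)_{i\in I,h\in\Omega}$. Such an element determines the linear maps $$A_\alpha: W'_\alpha\oplus\bigoplus_{h:\,t(h)=\alpha}W_{s(h)}\to W_\alpha,\quad (a,(b_h)_h)\mapsto x_\alpha(a)+\sum_h y_h(b_h)\qquad(\alpha\in I_0),$$ $$A_\beta: W_\beta\to W'_\beta\oplus\bigoplus_{h:\,s(h)=\beta}W_{t(h)},\quad b\mapsto (x_\beta(b),(y_h(b))_h)\qquad(\beta\in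 I_1).$$ For a vector $u=(u_i)_{i\in I}$ of nonnegative integers let $$\mathbf{E}_{u,w}=\{\mathrm{rank}\,A_i\le u_i\ \forall i\in I\}\subseteq\mathbf{E}_w,\qquad \mathbf{E}^\circ_{u,w}=\{\mathrm{rank}\,A_i=u_i\ \forall i\in I\}\subseteq\mathbf{E}_w .$$ Let $Gr(d,E)$ be the Grassmannian of $d$-dimensional subspaces of $E$ (empty if $d>\dim E$), and $Gr(d,e)=Gr(d,\mathbb{C}^e)$. Let $\mathcal{F}_{v,w}$ be the variety of tuples $(X_i)_{i\in I}$ of subspaces $X_\alpha\subseteq W_\alpha$ ($\alpha\in I_0$) and $X_\beta\subseteq W'_\beta\oplus\bigoplus_{h:\,s(h)=\beta}X_{t(h)}$ ($\beta\in I_1$) with $\dim X_i=v_i$ for all $i$. Let $\tilde{\mathcal{F}}_{v,w}$ be the variety of all $(x_i,y_h,X_i)$ with $(x_i,y_h)\in\mathbf{E}_w$, $(X_i)\in\mathcal{F}_{v,w}$ and $\mathrm{im}\,A_i\subseteq X_i$ for all $i\in I$, and let $\pi:\tilde{\mathcal{F}}_{v,w}\to\mathbf{E}_{v,w}$ be the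 projection $(x_i,y_h,X_i)\mapsto(x_i,y_h)$. The pair $(u,w)$ is called $l$-dominant if for all $i\in I$ $$w_i\ge u_i,\qquad w'_i\ge u_i-\sum_{h:\,i-j}u_j,$$ where the sum runs over all arrows $h$ with an endpoint $i$, and $j$ is the other endpoint of $h$. All varieties are complex varieties with the Zariski topology, and $u\le v$ means $u_i\le v_i$ for all $i$. (a) For each $v'\le v$, the set $\mathbf{E}^\circ_{v',w}$ is nonempty if and only if $(v',w)$ is $l$-dominant. In this case it is nonsingular, locally closed in $\mathbf{E}_w$ and in $\mathbf{E}_{v,w}$, irreducible and rational. The variety $\mathbf{E}_{v,w}$ has the stratification $$\mathbf{E}_{v,w}=\bigcup_{v'}\mathbf{E}^\circ_{v',w},\qquad v'\le v,\ (v',w)\ l\text{-dominant},$$ that is, $\mathbf{E}_{v,w}$ is the disjoint union of these finitely many nonempty, nonsingular, locally closed strata, and the closure of $\mathbf{E}^\circ_{v',w}$ in $\mathbf{E}_{v,w}$ is contained in the union of the strata $\mathbf{E}^\circ_{v'',w}$ with $v''\le v'$. (b) For each $v'\le v$ with $(v',w)$ $l$-dominant, the restricted projection $\pi^{-1}(\mathbf{E}^\circ_{v',w})\to\mathbf{E}^\circ_{v',w}$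 is a Zariski locally trivial bundle with fiber the variety $$\mathcal{M}=\Big\{(X'_i)_{i\in I}\ \Big|\ X'_\alpha\in Gr(v_\alpha-v'_\alpha,\,w_\alpha-v'_\alpha)\ (\forall\alpha\in I_0),\ X'_\beta\in Gr\Big(v_\beta-v'_\beta,\ \mathbb{C}^{\,w'_\beta-v'_\beta+\sum_{h:\,s(h)=\beta}v'_{t(h)}}\oplus\bigoplus_{h:\,s(h)=\beta}X'_{t(h)}\Big)\ (\forall\beta\in I_1)\Big\},$$ and via $(X'_i)_{i\in I}\mapsto(X'_\alpha)_{\alpha\in I_0}$ the variety $\mathcal{M}$ is itself a Zariski locally trivial bundle over $\prod_{\alpha\in I_0}Gr(v_\alpha-v'_\alpha,\,w_\alpha-v'_\alpha)$ with fiber $\prod_{\beta\in I_1}Gr\big(v_\beta-v'_\beta,\ w'_\beta-v'_\beta+\sum_{h:\,s(h)=\beta}v_{t(h)}\big)$. In particular, via $(X_i)_{i\in I}\mapsto(X_\alpha)_{\alpha\in I_0}$ the variety $\mathcal{F}_{v,w}$ is a Zariski locally trivial bundle over $\prod_{\alpha\in I_0}Gr(v_\alpha,w_\alpha)$ with fiber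 $\prod_{\beta\in I_1}Gr\big(v_\beta,\ w'_\beta+\sum_{h:\,s(h)=\beta}v_{t(h)}\big)$. -/

import Mathlib

open Topology

noncomputable section

/-! ### Complex algebraic varieties as spaces with functions -/

/-- A (complex) *space with functions*: a topological space together with a sheaf of `ℂ`-algebras of
`ℂ`-valued functions (the regular functions), such that the non-vanishing locus of a regular
function is open and the function is invertible there.  A function on `U ⊆ X` is given by a function
on `X` of which only the values on `U` matter (see `glue`). Classical complex varieties form a full
subcategory of the spaces with functions. -/
structure SpaceWithFunctions (X : Type*) extends TopologicalSpace X where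
  /-- `IsRegularOn U f`: the set `U` is open and `f` is a regular function on `U`. -/
  IsRegularOn : Set X → (X → ℂ) → Prop
  isOpen_of_regular : ∀ {U f}, IsRegularOn U f → IsOpen[toTopologicalSpace] U
  glue : ∀ {U : Set X} {f : X → ℂ}, IsOpen[toTopologicalSpace] U →
    (∀ x ∈ U, ∃ V g, IsRegularOn V g ∧ x ∈ V ∧ ∀ y ∈ V, y ∈ U → f y = g y) → IsRegularOn U f
  restrict : ∀ {U V f}, IsRegularOn U f → IsOpen[toTopologicalSpace] V → V ⊆ U → IsRegularOn V f
  const : ∀ c : ℂ, IsRegularOn Set.univ (fun _ => c)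
  add : ∀ {U f g}, IsRegularOn U f → IsRegularOn U g → IsRegularOn U (fun x => f x + g x)
  mul : ∀ {U f g}, IsRegularOn U f → IsRegularOn U g → IsRegularOn U (fun x => f x * g x)
  isOpen_ne : ∀ {U f}, IsRegularOn U f → IsOpen[toTopologicalSpace] {x | x ∈ U ∧ f x ≠ 0}
  inv : ∀ {U f}, IsRegularOn U f → (∀ x ∈ U, f x ≠ 0) → IsRegularOn U (fun x => (f x)⁻¹)

/-- Morphisms pull back regular functions to regular functions.  (Since constants are regular
on every open set, such a map is continuous.) -/
def IsMorphism {X Y : Type*} (S : SpaceWithFunctions X) (T : SpaceWithFunctions Y)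
    (f : X → Y) : Prop :=
  ∀ U g, T.IsRegularOn U g → S.IsRegularOn (f ⁻¹' U) (g ∘ f)

/-- A bijection that is a morphism in both directions. -/
def IsIsomorphism {X Y : Type*} (S : SpaceWithFunctions X) (T : SpaceWithFunctions Y)
    (e : X ≃ Y) : Prop :=
  IsMorphism S T e ∧ IsMorphism T S e.symm

namespace SpaceWithFunctions

/-- The induced structure on a subset: the subspace topology, and the functions that are
locally restrictions of regular functions. -/
def sub {X : Type*} (S : SpaceWithFunctions X) (s : Set X) : SpaceWithFunctions s where
  toTopologicalSpace := S.toTopologicalSpace.induced Subtype.val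
  IsRegularOn U f := IsOpen[S.toTopologicalSpace.induced Subtype.val] U ∧
    ∀ x ∈ U, ∃ V g, S.IsRegularOn V g ∧ x.1 ∈ V ∧ ∀ y : s, y.1 ∈ V → y ∈ U → f y = g y.1
  isOpen_of_regular h := h.1
  glue {U f} hU h := by
    let _ := S.toTopologicalSpace
    refine ⟨hU, fun x hx => ?_⟩
    obtain ⟨V, g, ⟨hV, hg⟩, hxV, hfg⟩ := h x hx
    obtain ⟨V', g', hg', hxV', hgg'⟩ := hg x hxV
    obtain ⟨O, hO, rfl⟩ := hV
    exact ⟨V' ∩ O, g', S.restrict hg' ((S.isOpen_of_regular hg').inter hO) Set.inter_subset_left,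
      ⟨hxV', hxV⟩, fun y hy hyU => (hfg y hy.2 hyU).trans (hgg' y hy.1 hy.2)⟩
  restrict {U V f} h hV hVU := by
    refine ⟨hV, fun x hx => ?_⟩
    obtain ⟨O, g, hg, hxO, hfg⟩ := h.2 x (hVU hx)
    exact ⟨O, g, hg, hxO, fun y hy hyV => hfg y hy (hVU hyV)⟩
  const c := by
    let _ := S.toTopologicalSpace
    exact ⟨isOpen_univ, fun x _ => ⟨Set.univ, _, S.const c, trivial, fun _ _ _ => rfl⟩⟩
  add {U f g} hf hg := by
    let _ := S.toTopologicalSpace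
    refine ⟨hf.1, fun x hx => ?_⟩
    obtain ⟨V, f', hf', hxV, hff'⟩ := hf.2 x hx
    obtain ⟨V', g', hg', hxV', hgg'⟩ := hg.2 x hx
    have ho := (S.isOpen_of_regular hf').inter (S.isOpen_of_regular hg')
    refine ⟨V ∩ V', _, S.add (S.restrict hf' ho Set.inter_subset_left)
      (S.restrict hg' ho Set.inter_subset_right), ⟨hxV, hxV'⟩, fun y hy hyU => ?_⟩
    exact congrArg₂ _ (hff' y hy.1 hyU) (hgg' y hy.2 hyU)
  mul {U f g} hf hg := by
    let _ := S.toTopologicalSpace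
    refine ⟨hf.1, fun x hx => ?_⟩
    obtain ⟨V, f', hf', hxV, hff'⟩ := hf.2 x hx
    obtain ⟨V', g', hg', hxV', hgg'⟩ := hg.2 x hx
    have ho := (S.isOpen_of_regular hf').inter (S.isOpen_of_regular hg')
    refine ⟨V ∩ V', _, S.mul (S.restrict hf' ho Set.inter_subset_left)
      (S.restrict hg' ho Set.inter_subset_right), ⟨hxV, hxV'⟩, fun y hy hyU => ?_⟩
    exact congrArg₂ _ (hff' y hy.1 hyU) (hgg' y hy.2 hyU)
  isOpen_ne {U f} hf := by
    let _ := S.toTopologicalSpace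
    refine isOpen_iff_forall_mem_open.2 fun x hx => ?_
    obtain ⟨V, f', hf', hxV, hff'⟩ := hf.2 x hx.1
    refine ⟨U ∩ Subtype.val ⁻¹' {z | z ∈ V ∧ f' z ≠ 0}, fun y hy => ⟨hy.1, ?_⟩,
      hf.1.inter ⟨_, S.isOpen_ne hf', rfl⟩, hx.1, hxV, ?_⟩
    · rw [hff' y hy.2.1 hy.1]; exact hy.2.2
    · rw [← hff' x hxV hx.1]; exact hx.2
  inv {U f} hf h0 := by
    let _ := S.toTopologicalSpace
    refine ⟨hf.1, fun x hx => ?_⟩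
    obtain ⟨V, f', hf', hxV, hff'⟩ := hf.2 x hx
    refine ⟨{z | z ∈ V ∧ f' z ≠ 0}, _, S.inv (S.restrict hf' (S.isOpen_ne hf') fun z hz => hz.1)
      fun z hz => hz.2, ⟨hxV, ?_⟩, fun y hy hyU => ?_⟩
    · rw [← hff' x hxV hx]; exact h0 x hx
    · exact congrArg _ (hff' y hy.1 hyU)

/-- The quotient structure along a map `q : X → Y`: a set is open, a function is regular, if its
pullback to `X` is. -/
def coinduced {X Y : Type*} (S : SpaceWithFunctions X) (q : X → Y) : SpaceWithFunctions Y where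
  toTopologicalSpace := S.toTopologicalSpace.coinduced q
  IsRegularOn U f := S.IsRegularOn (q ⁻¹' U) (f ∘ q)
  isOpen_of_regular h := S.isOpen_of_regular h
  glue hU h := S.glue hU fun x hx => by
    obtain ⟨V, g, hg, hxV, hfg⟩ := h (q x) hx
    exact ⟨_, _, hg, hxV, fun y hy hyU => hfg (q y) hy hyU⟩
  restrict h hV hVU := S.restrict h hV (Set.preimage_mono hVU)
  const c := S.const c
  add := S.add
  mul := S.mul
  isOpen_ne h := S.isOpen_ne h
  inv h h0 := S.inv h fun x hx => h0 (q x) hx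

/-- The largest structure contained in all structures of a given set of structures on `X`: a set is
open, a function is regular, if it is so for every member of the set. -/
def inf {X : Type*} (C : Set (SpaceWithFunctions X)) : SpaceWithFunctions X where
  IsOpen U := ∀ S ∈ C, IsOpen[S.toTopologicalSpace] U
  isOpen_univ S _ := S.isOpen_univ
  isOpen_inter U V hU hV S hS := S.isOpen_inter U V (hU S hS) (hV S hS)
  isOpen_sUnion s h S hS := S.isOpen_sUnion s fun t ht => h t ht S hS
  IsRegularOn U f := ∀ S ∈ C, S.IsRegularOn U f
  isOpen_of_regular h S hS := S.isOpen_of_regular (h S hS)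
  glue hU h S hS := S.glue (hU S hS) fun x hx => by
    obtain ⟨V, g, hg, hx⟩ := h x hx
    exact ⟨V, g, hg S hS, hx⟩
  restrict h hV hVU S hS := S.restrict (h S hS) (hV S hS) hVU
  const c S _ := S.const c
  add hf hg S hS := S.add (hf S hS) (hg S hS)
  mul hf hg S hS := S.mul (hf S hS) (hg S hS)
  isOpen_ne h S hS := S.isOpen_ne (h S hS)
  inv h h0 S hS := S.inv (h S hS) h0

/-- The product of two spaces with functions: the smallest structure for which
both projections are morphisms (so its topology is finer than the product topology). -/
def prod {X Y : Type*} (S : SpaceWithFunctions X) (T : SpaceWithFunctions Y) :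
    SpaceWithFunctions (X × Y) :=
  inf {R | IsMorphism R S Prod.fst ∧ IsMorphism R T Prod.snd}

/-- The product of a family of spaces with functions: the smallest structure for
which all projections are morphisms. -/
def pi {ι : Type*} {X : ι → Type*} (S : ∀ i, SpaceWithFunctions (X i)) :
    SpaceWithFunctions (∀ i, X i) :=
  inf {R | ∀ i, IsMorphism R (S i) (fun x => x i)}

/-- The local ring at `x`: the germs at `x` of functions that are regular near `x`. -/
def localRing {X : Type*} (S : SpaceWithFunctions X) (x : X) :
    Subring (Filter.Germ (@nhds X S.toTopologicalSpace x) ℂ) where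
  carrier := {a | ∃ U f, S.IsRegularOn U f ∧ x ∈ U ∧ a = (f : Filter.Germ _ ℂ)}
  one_mem' := ⟨Set.univ, _, S.const 1, trivial, rfl⟩
  zero_mem' := ⟨Set.univ, _, S.const 0, trivial, rfl⟩
  mul_mem' := by
    let _ := S.toTopologicalSpace
    rintro _ _ ⟨U, f, hf, hxU, rfl⟩ ⟨V, g, hg, hxV, rfl⟩
    have ho := (S.isOpen_of_regular hf).inter (S.isOpen_of_regular hg)
    exact ⟨U ∩ V, _, S.mul (S.restrict hf ho Set.inter_subset_left)
      (S.restrict hg ho Set.inter_subset_right), ⟨hxU, hxV⟩, rfl⟩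
  add_mem' := by
    let _ := S.toTopologicalSpace
    rintro _ _ ⟨U, f, hf, hxU, rfl⟩ ⟨V, g, hg, hxV, rfl⟩
    have ho := (S.isOpen_of_regular hf).inter (S.isOpen_of_regular hg)
    exact ⟨U ∩ V, _, S.add (S.restrict hf ho Set.inter_subset_left)
      (S.restrict hg ho Set.inter_subset_right), ⟨hxU, hxV⟩, rfl⟩
  neg_mem' := by
    let _ := S.toTopologicalSpace
    rintro _ ⟨U, f, hf, hxU, rfl⟩
    refine ⟨U, _, S.mul (S.restrict (S.const (-1)) (S.isOpen_of_regular hf)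
      (Set.subset_univ U)) hf, hxU, ?_⟩
    rw [← Filter.Germ.coe_neg]
    congr 1
    funext y
    simp

/-- Nonsingular: all local rings are regular local rings. -/
def IsNonsingular {X : Type*} (S : SpaceWithFunctions X) : Prop :=
  ∀ x, IsRegularLocalRing (S.localRing x)

/-- Irreducible (in particular non-empty) in the Zariski topology. -/
def IsIrred {X : Type*} (S : SpaceWithFunctions X) : Prop :=
  @IrreducibleSpace X S.toTopologicalSpace

/-- A stratification, indexed by a finite poset: a partition into non-empty, nonsingular, locally
closed subsets such that the closure of a stratum is contained in the union of the smaller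
strata. -/
structure IsStratification {X ι : Type*} [PartialOrder ι] (S : SpaceWithFunctions X)
    (P : ι → Set X) : Prop where
  finite : Finite ι
  nonempty : ∀ i, (P i).Nonempty
  disjoint : Pairwise fun i j => Disjoint (P i) (P j)
  iUnion_eq : ⋃ i, P i = Set.univ
  isLocallyClosed : ∀ i, @IsLocallyClosed X S.toTopologicalSpace (P i)
  isNonsingular : ∀ i, (S.sub (P i)).IsNonsingular
  closure_subset : ∀ i, @closure X S.toTopologicalSpace (P i) ⊆ ⋃ j ≤ i, P j

/-- `f : X → Y` is a Zariski locally trivial bundle with fiber `F`. -/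
def IsLocallyTrivialBundle {X Y F : Type*} (S : SpaceWithFunctions X) (T : SpaceWithFunctions Y)
    (R : SpaceWithFunctions F) (f : X → Y) : Prop :=
  ∀ y, ∃ U : Set Y, IsOpen[T.toTopologicalSpace] U ∧ y ∈ U ∧
    ∃ e : (f ⁻¹' U) ≃ U × F,
      IsIsomorphism (S.sub (f ⁻¹' U)) ((T.sub U).prod R) e ∧ ∀ x, ((e x).1 : Y) = f x

end SpaceWithFunctions

/-! ### Affine spaces and Grassmannians -/

/-- The polynomial functions on a vector space: the algebra generated by the linear functionals. -/
def polyFunctions (E : Type*) [AddCommGroup E] [Module ℂ E] : Subalgebra ℂ (E → ℂ) :=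
  Algebra.adjoin ℂ (Set.range fun (l : Module.Dual ℂ E) (x : E) => l x)

/-- A finite-dimensional vector space as an affine variety: the open sets are the unions of
non-vanishing loci of polynomials, the regular functions are locally quotients of
polynomials. -/
def affineSpace (E : Type*) [AddCommGroup E] [Module ℂ E] : SpaceWithFunctions E where
  IsOpen U := ∀ x ∈ U, ∃ Q ∈ polyFunctions E, Q x ≠ 0 ∧ ∀ y, Q y ≠ 0 → y ∈ U
  isOpen_univ x _ := ⟨1, one_mem _, by simp, fun _ _ => trivial⟩
  isOpen_inter U V hU hV x hx := by
    obtain ⟨Q, hQ, hQx, hQU⟩ := hU x hx.1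
    obtain ⟨R, hR, hRx, hRV⟩ := hV x hx.2
    exact ⟨Q * R, mul_mem hQ hR, mul_ne_zero hQx hRx, fun y hy =>
      ⟨hQU y (left_ne_zero_of_mul hy), hRV y (right_ne_zero_of_mul hy)⟩⟩
  isOpen_sUnion s h x hx := by
    obtain ⟨t, ht, hxt⟩ := hx
    obtain ⟨Q, hQ, hQx, hQt⟩ := h t ht x hxt
    exact ⟨Q, hQ, hQx, fun y hy => ⟨t, ht, hQt y hy⟩⟩
  IsRegularOn U f := ∀ x ∈ U, ∃ P ∈ polyFunctions E, ∃ Q ∈ polyFunctions E,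
    Q x ≠ 0 ∧ ∀ y, Q y ≠ 0 → y ∈ U ∧ f y = P y / Q y
  isOpen_of_regular h x hx := by
    obtain ⟨P, _, Q, hQ, hQx, hy⟩ := h x hx
    exact ⟨Q, hQ, hQx, fun y h => (hy y h).1⟩
  glue {U f} hU h x hx := by
    obtain ⟨V, g, hg, hxV, hfg⟩ := h x hx
    obtain ⟨P, hP, Q, hQ, hQx, hy⟩ := hg x hxV
    obtain ⟨R, hR, hRx, hRU⟩ := hU x hx
    refine ⟨P * R, mul_mem hP hR, Q * R, mul_mem hQ hR, mul_ne_zero hQx hRx, fun y h => ?_⟩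
    have h1 : Q y ≠ 0 := left_ne_zero_of_mul h
    have h2 : R y ≠ 0 := right_ne_zero_of_mul h
    refine ⟨hRU y h2, ?_⟩
    rw [hfg y (hy y h1).1 (hRU y h2), (hy y h1).2, Pi.mul_apply, Pi.mul_apply,
      mul_div_mul_right _ _ h2]
  restrict {U V f} hf hV hVU x hx := by
    obtain ⟨P, hP, Q, hQ, hQx, hy⟩ := hf x (hVU hx)
    obtain ⟨R, hR, hRx, hRU⟩ := hV x hx
    refine ⟨P * R, mul_mem hP hR, Q * R, mul_mem hQ hR, mul_ne_zero hQx hRx, fun y h => ?_⟩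
    have h1 : Q y ≠ 0 := left_ne_zero_of_mul h
    have h2 : R y ≠ 0 := right_ne_zero_of_mul h
    refine ⟨hRU y h2, ?_⟩
    rw [(hy y h1).2, Pi.mul_apply, Pi.mul_apply, mul_div_mul_right _ _ h2]
  const c x _ := ⟨algebraMap ℂ _ c, Subalgebra.algebraMap_mem _ c, 1, one_mem _, by simp,
    fun y _ => ⟨trivial, by simp⟩⟩
  add {U f g} hf hg x hx := by
    obtain ⟨P, hP, Q, hQ, hQx, hy⟩ := hf x hx
    obtain ⟨P', hP', Q', hQ', hQx', hy'⟩ := hg x hx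
    refine ⟨P * Q' + Q * P', add_mem (mul_mem hP hQ') (mul_mem hQ hP'), Q * Q', mul_mem hQ hQ',
      mul_ne_zero hQx hQx', fun y h => ?_⟩
    have h1 : Q y ≠ 0 := left_ne_zero_of_mul h
    have h2 : Q' y ≠ 0 := right_ne_zero_of_mul h
    refine ⟨(hy y h1).1, ?_⟩
    beta_reduce
    rw [(hy y h1).2, (hy' y h2).2, div_add_div _ _ h1 h2]
    rfl
  mul {U f g} hf hg x hx := by
    obtain ⟨P, hP, Q, hQ, hQx, hy⟩ := hf x hx
    obtain ⟨P', hP', Q', hQ', hQx', hy'⟩ := hg x hx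
    refine ⟨P * P', mul_mem hP hP', Q * Q', mul_mem hQ hQ',
      mul_ne_zero hQx hQx', fun y h => ?_⟩
    have h1 : Q y ≠ 0 := left_ne_zero_of_mul h
    have h2 : Q' y ≠ 0 := right_ne_zero_of_mul h
    refine ⟨(hy y h1).1, ?_⟩
    beta_reduce
    rw [(hy y h1).2, (hy' y h2).2, div_mul_div_comm]
    rfl
  isOpen_ne {U f} hf x hx := by
    obtain ⟨P, hP, Q, hQ, hQx, hy⟩ := hf x hx.1
    have hPx : P x ≠ 0 := fun h => hx.2 (by rw [(hy x hQx).2, h, zero_div])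
    refine ⟨P * Q, mul_mem hP hQ, mul_ne_zero hPx hQx, fun y h => ?_⟩
    have h1 : P y ≠ 0 := left_ne_zero_of_mul h
    have h2 : Q y ≠ 0 := right_ne_zero_of_mul h
    exact ⟨(hy y h2).1, by rw [(hy y h2).2]; exact div_ne_zero h1 h2⟩
  inv {U f} hf h0 x hx := by
    obtain ⟨P, hP, Q, hQ, hQx, hy⟩ := hf x hx
    have hPx : P x ≠ 0 := fun h => h0 x hx (by rw [(hy x hQx).2, h, zero_div])
    refine ⟨Q * Q, mul_mem hQ hQ, P * Q, mul_mem hP hQ, mul_ne_zero hPx hQx, fun y h => ?_⟩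
    have h2 : Q y ≠ 0 := right_ne_zero_of_mul h
    refine ⟨(hy y h2).1, ?_⟩
    beta_reduce
    rw [(hy y h2).2, inv_div, Pi.mul_apply, Pi.mul_apply, mul_div_mul_right _ _ h2]

/-- Rational: irreducible, and some non-empty open subset is isomorphic to a non-empty
open subset of an affine space `ℂᵐ`. -/
def SpaceWithFunctions.IsRational {X : Type*} (S : SpaceWithFunctions X) : Prop :=
  S.IsIrred ∧ ∃ (m : ℕ) (U : Set X) (V : Set (Fin m → ℂ)),
    IsOpen[S.toTopologicalSpace] U ∧ U.Nonempty ∧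
    IsOpen[(affineSpace (Fin m → ℂ)).toTopologicalSpace] V ∧ V.Nonempty ∧
    ∃ e : U ≃ V, IsIsomorphism (S.sub U) ((affineSpace (Fin m → ℂ)).sub V) e

/-- The Grassmannian of `d`-dimensional subspaces of a finite-dimensional vector space `E`
(empty if `d > dim E`). -/
abbrev Gr (d : ℕ) (E : Type*) [AddCommGroup E] [Module ℂ E] : Type _ :=
  {X : Submodule ℂ E // Module.finrank ℂ X = d}

/-- The `d`-frames in `E`, an open subset of the affine space `Eᵈ`. -/
def frames (d : ℕ) (E : Type*) [AddCommGroup E] [Module ℂ E] : Set (Fin d → E) :=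
  {b | LinearIndependent ℂ b}

/-- The subspace spanned by a frame. -/
def frameSpan (d : ℕ) (E : Type*) [AddCommGroup E] [Module ℂ E] (b : frames d E) : Gr d E :=
  ⟨Submodule.span ℂ (Set.range b.1), by simpa using finrank_span_eq_card b.2⟩

/-- The Grassmannian as a variety: the quotient of the variety of `d`-frames by `GL_d`. -/
def grassmannian (d : ℕ) (E : Type*) [AddCommGroup E] [Module ℂ E] : SpaceWithFunctions (Gr d E) :=
  ((affineSpace (Fin d → E)).sub (frames d E)).coinduced (frameSpan d E)

/-! ### Graded quiver varieties of a bipartite quiver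

The vertex set is `I = I₀ ⊕ I₁`, and `Ω β α` is the set of arrows `β → α` for `β ∈ I₁`, `α ∈ I₀`,
so that the vertices in `I₀` are sinks and those in `I₁` are sources.  The set of arrows with
target `α` is `Σ β, Ω β α`, that of arrows with source `β` is `Σ α, Ω β α`. -/

section Quiver

variable {I₀ I₁ : Type*} [Fintype I₀] [Fintype I₁] (Ω : I₁ → I₀ → Type*) [∀ β α, Fintype (Ω β α)]

/-- `∑ v_j` over all arrows `h : i - j` with an endpoint `i`. -/
def adjacentSum (v : I₀ ⊕ I₁ → ℕ) : I₀ ⊕ I₁ → ℕ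
  | .inl α => ∑ h : (Σ β, Ω β α), v (.inr h.1)
  | .inr β => ∑ h : (Σ α, Ω β α), v (.inl h.1)

/-- `(v, w)` is `l`-dominant: `w - C_q v ≥ 0`, where `C_q v = (v_i, v_i - ∑_{h : i - j} v_j)_i`.
The dimension vector `(w_i, w'_i)_i` is given as the pair of `w` and `w'`. -/
def LDominant (v w w' : I₀ ⊕ I₁ → ℕ) : Prop :=
  ∀ i, (v i : ℤ) ≤ w i ∧ (v i : ℤ) - adjacentSum Ω v i ≤ w' i

/-- The representation space `E_w`; its elements are `(x_α, x_β, y_h)`. -/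
abbrev RepSpace (w w' : I₀ ⊕ I₁ → ℕ) : Type _ :=
  (∀ α : I₀, (Fin (w' (.inl α)) → ℂ) →ₗ[ℂ] (Fin (w (.inl α)) → ℂ)) ×
  (∀ β : I₁, (Fin (w (.inr β)) → ℂ) →ₗ[ℂ] (Fin (w' (.inr β)) → ℂ)) ×
  (∀ (β : I₁) (α : I₀), Ω β α → ((Fin (w (.inr β)) → ℂ) →ₗ[ℂ] (Fin (w (.inl α)) → ℂ)))

variable {Ω}

/-- `A_α : W'_α ⊕ ⨁_{t(h) = α} W_{s(h)} → W_α`, `(a, b) ↦ x_α a + ∑_h y_h b_h`. -/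
def sinkMap {w w' : I₀ ⊕ I₁ → ℕ} (e : RepSpace Ω w w') (α : I₀) :
    (Fin (w' (.inl α)) → ℂ) × (∀ h : (Σ β, Ω β α), Fin (w (.inr h.1)) → ℂ) →ₗ[ℂ]
      (Fin (w (.inl α)) → ℂ) :=
  (e.1 α).coprod (∑ h : (Σ β, Ω β α), e.2.2 h.1 α h.2 ∘ₗ LinearMap.proj h)

/-- `A_β : W_β → W'_β ⊕ ⨁_{s(h) = β} W_{t(h)}`, `b ↦ (x_β b, (y_h b)_h)`. -/
def sourceMap {w w' : I₀ ⊕ I₁ → ℕ} (e : RepSpace Ω w w') (β : I₁) :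
    (Fin (w (.inr β)) → ℂ) →ₗ[ℂ]
      (Fin (w' (.inr β)) → ℂ) × (∀ h : (Σ α, Ω β α), Fin (w (.inl h.1)) → ℂ) :=
  (e.2.1 β).prod (LinearMap.pi fun h : (Σ α, Ω β α) => e.2.2 β h.1 h.2)

/-- The rank of `A_i`. -/
def vertexRank {w w' : I₀ ⊕ I₁ → ℕ} (e : RepSpace Ω w w') : I₀ ⊕ I₁ → ℕ
  | .inl α => Module.finrank ℂ (LinearMap.range (sinkMap e α))
  | .inr β => Module.finrank ℂ (LinearMap.range (sourceMap e β))

variable (Ω)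

/-- The affine graded quiver variety `E_{v,w} = {rank A_i ≤ v_i for all i}`. -/
def affineQuiverVariety (v w w' : I₀ ⊕ I₁ → ℕ) : Set (RepSpace Ω w w') :=
  {e | ∀ i, vertexRank e i ≤ v i}

/-- The stratum `E°_{v,w} = {rank A_i = v_i for all i}`. -/
def stratum (v w w' : I₀ ⊕ I₁ → ℕ) : Set (RepSpace Ω w w') :=
  {e | ∀ i, vertexRank e i = v i}

/-- The space `∏_α Gr(d_α, ℂ^{a_α}) × ∏_β Gr(d_β, ℂ^{b_β} ⊕ ⨁_{s(h) = β} ℂ^{a_{t(h)}})`. -/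
abbrev GrProduct (d : I₀ ⊕ I₁ → ℕ) (a : I₀ → ℕ) (b : I₁ → ℕ) : Type _ :=
  (∀ α : I₀, Gr (d (.inl α)) (Fin (a α) → ℂ)) ×
  (∀ β : I₁, Gr (d (.inr β)) ((Fin (b β) → ℂ) × (∀ h : (Σ α, Ω β α), Fin (a h.1) → ℂ)))

/-- `GrProduct` as a variety. -/
def grProductSpace (d : I₀ ⊕ I₁ → ℕ) (a : I₀ → ℕ) (b : I₁ → ℕ) :
    SpaceWithFunctions (GrProduct Ω d a b) :=
  (SpaceWithFunctions.pi fun _ => grassmannian _ _).prod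
    (SpaceWithFunctions.pi fun _ => grassmannian _ _)

/-- The tuples `(X_i)_i` with `X_α ∈ Gr(d_α, ℂ^{a_α})` for `α ∈ I₀` and
`X_β ∈ Gr(d_β, ℂ^{b_β} ⊕ ⨁_{s(h) = β} X_{t(h)})` for `β ∈ I₁`. -/
def towerVariety (d : I₀ ⊕ I₁ → ℕ) (a : I₀ → ℕ) (b : I₁ → ℕ) : Set (GrProduct Ω d a b) :=
  {X | ∀ β, (X.2 β).1 ≤ Submodule.prod ⊤
    (Submodule.pi Set.univ fun h : (Σ α, Ω β α) => (X.1 h.1).1)}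

/-- The projection `(X_i)_{i ∈ I} ↦ (X_α)_{α ∈ I₀}`. -/
def towerProj (d : I₀ ⊕ I₁ → ℕ) (a : I₀ → ℕ) (b : I₁ → ℕ) (X : towerVariety Ω d a b) :
    ∀ α : I₀, Gr (d (.inl α)) (Fin (a α) → ℂ) :=
  X.1.1

/-- The projective variety `F_{v,w}`. -/
abbrev flagVariety (v w w' : I₀ ⊕ I₁ → ℕ) : Set (GrProduct Ω v (w ∘ .inl) (w' ∘ .inr)) :=
  towerVariety Ω v (w ∘ .inl) (w' ∘ .inr)

/-- The nonsingular graded quiver variety `F̃_{v,w}`: the pairs of a representation and a tuple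
`(X_i)_i ∈ F_{v,w}` with `im A_i ⊆ X_i` for all `i`. -/
def nonsingularQuiverVariety (v w w' : I₀ ⊕ I₁ → ℕ) :
    Set (RepSpace Ω w w' × GrProduct Ω v (w ∘ .inl) (w' ∘ .inr)) :=
  {p | p.2 ∈ flagVariety Ω v w w' ∧ (∀ α, LinearMap.range (sinkMap p.1 α) ≤ (p.2.1 α).1) ∧
    ∀ β, LinearMap.range (sourceMap p.1 β) ≤ (p.2.2 β).1}

/-- The projection `π : F̃_{v,w} → E_{v,w}`. -/
def quiverProj (v w w' : I₀ ⊕ I₁ → ℕ) (p : nonsingularQuiverVariety Ω v w w') :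
    affineQuiverVariety Ω v w w' :=
  ⟨p.1.1, fun i => match i with
    | .inl α => (Submodule.finrank_mono (p.2.2.1 α)).trans_eq (p.1.2.1 α).2
    | .inr β => (Submodule.finrank_mono (p.2.2.2 β)).trans_eq (p.1.2.2 β).2⟩

/-- `E_w` as a variety. -/
def repSpace (w w' : I₀ ⊕ I₁ → ℕ) : SpaceWithFunctions (RepSpace Ω w w') :=
  affineSpace (RepSpace Ω w w')

/-- `E_{v,w}` as a variety. -/
def affineQuiverSpace (v w w' : I₀ ⊕ I₁ → ℕ) :
    SpaceWithFunctions (affineQuiverVariety Ω v w w') :=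
  (repSpace Ω w w').sub _

/-- `F_{v,w}` as a variety. -/
def flagSpace (v w w' : I₀ ⊕ I₁ → ℕ) : SpaceWithFunctions (flagVariety Ω v w w') :=
  (grProductSpace Ω v (w ∘ .inl) (w' ∘ .inr)).sub _

/-- `F̃_{v,w}` as a variety. -/
def nonsingularQuiverSpace (v w w' : I₀ ⊕ I₁ → ℕ) :
    SpaceWithFunctions (nonsingularQuiverVariety Ω v w w') :=
  ((repSpace Ω w w').prod (grProductSpace Ω v (w ∘ .inl) (w' ∘ .inr))).sub _

/-- `E°_{u,w}` as a subset of `E_{v,w}` (for `u ≤ v` this is all of `E°_{u,w}`). -/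
def stratumIn (u v w w' : I₀ ⊕ I₁ → ℕ) : Set (affineQuiverVariety Ω v w w') :=
  Subtype.val ⁻¹' stratum Ω u w w'

/-- The dimensions `w_α - u_α`, `α ∈ I₀`. -/
def sinkDim (u w : I₀ ⊕ I₁ → ℕ) (α : I₀) : ℕ := w (.inl α) - u (.inl α)

/-- The dimensions `w'_β - u_β + ∑_{s(h) = β} u_{t(h)}`, `β ∈ I₁`; the subtraction is the honest
one if `(u, w)` is `l`-dominant. -/
def sourceDim (u w' : I₀ ⊕ I₁ → ℕ) (β : I₁) : ℕ :=
  w' (.inr β) + (∑ h : (Σ α, Ω β α), u (.inl h.1)) - u (.inr β)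

/-- The variety `M` of the tuples `(X'_i)_i` with `X'_α ∈ Gr(v_α - u_α, ℂ^{w_α - u_α})` and
`X'_β ∈ Gr(v_β - u_β, ℂ^{w'_β - u_β + ∑ u_{t(h)}} ⊕ ⨁_{s(h) = β} X'_{t(h)})`. -/
abbrev fiberVariety (u v w w' : I₀ ⊕ I₁ → ℕ) :
    Set (GrProduct Ω (v - u) (sinkDim u w) (sourceDim Ω u w')) :=
  towerVariety Ω (v - u) (sinkDim u w) (sourceDim Ω u w')

/-- `M` as a variety. -/
def fiberSpace (u v w w' : I₀ ⊕ I₁ → ℕ) : SpaceWithFunctions (fiberVariety Ω u v w w') :=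
  (grProductSpace Ω (v - u) (sinkDim u w) (sourceDim Ω u w')).sub _

end Quiver

end

/-!
A representation lies in `E°_{u,w}` exactly when it factors through injections `j_α : U_α → W_α`,
surjections `q_β : W_β → U_β`, where `dim U_i = u_i`, and a representation `e` with the dimensions
`(u, w')` whose maps `A_i` all have full rank `u_i`. The triples `(e, j, q)` form an open subset of
an affine space, so that `E°_{u,w}` is irreducible. They are a torsor under `∏ GL(u_i)` over the
stratum, and the linear conditions `ρ ∘ j = id`, `q ∘ σ = id` cut out slices, which are charts of
the stratum: it is nonsingular and rational.

Over a stratum the images of the `A_i` have constant rank, so their cokernels have regular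
coordinates locally. Since the image of `y_h` lies in that of `A_{t(h)}`, the cokernel of `A_β`
surjects onto the sum of the cokernels of the `A_{t(h)}`, and the coordinates can be chosen
compatibly with these surjections; dividing out the images then trivializes `π`. The tower `M` is
trivial over products of big cells of the Grassmannians at the sinks.
-/

/-! ### Morphisms and regular maps -/

namespace IsMorphism

variable {X Y Z : Type*} {S : SpaceWithFunctions X} {T : SpaceWithFunctions Y}
  {R : SpaceWithFunctions Z}

theorem id : IsMorphism S S id := fun _ _ h => h

theorem comp {g : Y → Z} {f : X → Y} (hg : IsMorphism T R g) (hf : IsMorphism S T f) :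
    IsMorphism S R (g ∘ f) :=
  fun U h hh => hf _ _ (hg U h hh)

theorem isOpen_preimage {f : X → Y} (hf : IsMorphism S T f) {U : Set Y}
    (hU : IsOpen[T.toTopologicalSpace] U) : IsOpen[S.toTopologicalSpace] (f ⁻¹' U) :=
  S.isOpen_of_regular (hf U _ (T.restrict (T.const 0) hU (Set.subset_univ U)))

theorem tendsto {f : X → Y} (hf : IsMorphism S T f) (x : X) :
    Filter.Tendsto f (@nhds X S.toTopologicalSpace x) (@nhds Y T.toTopologicalSpace (f x)) := by
  let _ := S.toTopologicalSpace
  let _ := T.toTopologicalSpace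
  have hcont : Continuous f := ⟨fun _ hU => hf.isOpen_preimage hU⟩
  exact hcont.tendsto x

end IsMorphism

namespace SpaceWithFunctions

section Morphisms

variable {X Y Z : Type*} {S : SpaceWithFunctions X} {T : SpaceWithFunctions Y}
  {R : SpaceWithFunctions Z}

theorem isRegularOn_congr {U : Set X} {f g : X → ℂ} (hf : S.IsRegularOn U f)
    (h : ∀ x ∈ U, g x = f x) : S.IsRegularOn U g :=
  S.glue (S.isOpen_of_regular hf) fun _ hx => ⟨U, f, hf, hx, fun y hy _ => h y hy⟩

theorem isMorphism_val (s : Set X) : IsMorphism (S.sub s) S Subtype.val := fun U g hg =>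
  ⟨⟨U, S.isOpen_of_regular hg, rfl⟩, fun _ hx => ⟨U, g, hg, hx, fun _ _ _ => rfl⟩⟩

theorem isMorphism_sub_iff {t : Set Y} {f : X → t} :
    IsMorphism S (T.sub t) f ↔ IsMorphism S T fun x => (f x : Y) := by
  refine ⟨fun h => (isMorphism_val t).comp h, fun h U g hg => ?_⟩
  obtain ⟨⟨O, hO, rfl⟩, hg⟩ := hg
  refine S.glue (h.isOpen_preimage hO) fun x hx => ?_
  obtain ⟨V, g', hg', hxV, hgg'⟩ := hg (f x) hx
  exact ⟨_, _, h V g' hg', hxV, fun y hy hyU => hgg' (f y) hy hyU⟩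

theorem isOpen_image_val {s : Set X} (hs : IsOpen[S.toTopologicalSpace] s) {U : Set s}
    (hU : IsOpen[(S.sub s).toTopologicalSpace] U) :
    IsOpen[S.toTopologicalSpace] (Subtype.val '' U) := by
  let _ := S.toTopologicalSpace
  exact hs.isOpenMap_subtype_val U hU

theorem isRegularOn_sub_iff {s : Set X} (hs : IsOpen[S.toTopologicalSpace] s) {U : Set s}
    {f : s → ℂ} {g : X → ℂ} (h : ∀ x ∈ U, f x = g x) :
    (S.sub s).IsRegularOn U f ↔ S.IsRegularOn (Subtype.val '' U) g := by
  constructor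
  · intro hf
    refine S.glue (isOpen_image_val hs ((S.sub s).isOpen_of_regular hf)) ?_
    rintro _ ⟨x, hx, rfl⟩
    obtain ⟨V, g', hg', hxV, hgg'⟩ := hf.2 x hx
    refine ⟨V, g', hg', hxV, ?_⟩
    rintro _ hy ⟨y, hyU, rfl⟩
    rw [← h y hyU]
    exact hgg' y hy hyU
  · intro hg
    have hval := isMorphism_val s _ _ hg
    rw [Set.preimage_image_eq _ Subtype.val_injective] at hval
    exact isRegularOn_congr hval h

theorem isMorphism_of_local {f : X → Y} (h : ∀ x, ∃ U : Set X, IsOpen[S.toTopologicalSpace] U ∧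
    x ∈ U ∧ IsMorphism (S.sub U) T fun y => f y) : IsMorphism S T f := by
  let _ := S.toTopologicalSpace
  intro V g hg
  choose U hU hxU hf using h
  have regular_near (x : X) : S.IsRegularOn (U x ∩ f ⁻¹' V) (g ∘ f) := by
    have himage := (isRegularOn_sub_iff (hU x) (g := g ∘ f) (fun _ _ => rfl)).1 (hf x V g hg)
    rwa [← Function.comp_def f Subtype.val, Set.preimage_comp,
      Subtype.image_preimage_coe] at himage
  refine S.glue ?_ fun x hx => ⟨_, _, regular_near x, ⟨hxU x, hx⟩, fun _ _ _ => rfl⟩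
  rw [isOpen_iff_forall_mem_open]
  exact fun x hx =>
    ⟨_, Set.inter_subset_right, S.isOpen_of_regular (regular_near x), hxU x, hx⟩

theorem isMorphism_fst : IsMorphism (S.prod T) S Prod.fst :=
  fun U g hg _ hR => hR.1 U g hg

theorem isMorphism_snd : IsMorphism (S.prod T) T Prod.snd :=
  fun U g hg _ hR => hR.2 U g hg

theorem isMorphism_prod_iff {f : Z → X × Y} : IsMorphism R (S.prod T) f ↔
    (IsMorphism R S fun z => (f z).1) ∧ IsMorphism R T fun z => (f z).2 :=
  ⟨fun h => ⟨isMorphism_fst.comp h, isMorphism_snd.comp h⟩,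
    fun h _ _ hg => hg (R.coinduced f) ⟨h.1, h.2⟩⟩

theorem isMorphism_apply {ι : Type*} {X : ι → Type*} {S : ∀ i, SpaceWithFunctions (X i)} (i : ι) :
    IsMorphism (SpaceWithFunctions.pi S) (S i) fun x => x i :=
  fun U g hg _ hR => hR i U g hg

theorem isMorphism_pi_iff {ι : Type*} {X : ι → Type*} {S : ∀ i, SpaceWithFunctions (X i)}
    {f : Z → ∀ i, X i} : IsMorphism R (SpaceWithFunctions.pi S) f ↔
      ∀ i, IsMorphism R (S i) fun z => f z i :=
  ⟨fun h i => (isMorphism_apply i).comp h, fun h _ _ hg => hg (R.coinduced f) h⟩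

theorem isMorphism_coinduced (q : X → Y) : IsMorphism S (S.coinduced q) q :=
  fun _ _ hg => hg

theorem isMorphism_sub_coinduced {q : X → Y} {U : Set Y}
    (hU : IsOpen[S.toTopologicalSpace] (q ⁻¹' U)) {f : U → Z}
    (hf : IsMorphism (S.sub (q ⁻¹' U)) R fun x => f ⟨q x, x.2⟩) :
    IsMorphism ((S.coinduced q).sub U) R f := by
  classical
  intro V g hg
  let extension : Y → ℂ := fun y => if hy : y ∈ U then g (f ⟨y, hy⟩) else 0
  rw [isRegularOn_sub_iff (S := S.coinduced q) hU (g := extension)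
    fun x _ => by simp only [extension, dif_pos x.2, Function.comp_apply]]
  have hpull := (isRegularOn_sub_iff hU (g := extension ∘ q) fun x _ => by
    simp only [extension, Function.comp_apply, dif_pos (show q x ∈ U from x.2)]).1 (hf V g hg)
  change S.IsRegularOn (q ⁻¹' (Subtype.val '' (f ⁻¹' V))) (extension ∘ q)
  convert hpull using 1
  ext x
  simp

end Morphisms

section RegularMaps

variable {X Y : Type*} {S : SpaceWithFunctions X} {T : SpaceWithFunctions Y}
variable {E F G : Type*} [AddCommGroup E] [Module ℂ E] [AddCommGroup F] [Module ℂ F]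
  [AddCommGroup G] [Module ℂ G]

/-- The algebra of regular functions on the whole space. -/
def globalFunctions (S : SpaceWithFunctions X) : Subalgebra ℂ (X → ℂ) where
  carrier := {f | S.IsRegularOn Set.univ f}
  mul_mem' := S.mul
  add_mem' := S.add
  algebraMap_mem' := S.const

theorem isOpen_ne_zero {f : X → ℂ} (hf : f ∈ S.globalFunctions) :
    IsOpen[S.toTopologicalSpace] {x | f x ≠ 0} := by
  simpa only [Set.mem_univ, true_and] using S.isOpen_ne hf

/-- A regular map from a space with functions to a vector space: composing it with a linear
functional gives a regular function. This is a morphism to the affine space, see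
`isMorphism_affineSpace_iff`, but its definition makes sense in any dimension and is linear. -/
def IsRegularMap (S : SpaceWithFunctions X) (f : X → E) : Prop :=
  ∀ l : Module.Dual ℂ E, (fun x => l (f x)) ∈ S.globalFunctions

theorem IsRegularMap.polyFunctions_comp {f : X → E} (hf : S.IsRegularMap f) {P : E → ℂ}
    (hP : P ∈ polyFunctions E) : P ∘ f ∈ S.globalFunctions := by
  induction hP using Algebra.adjoin_induction with
  | mem P hP => obtain ⟨l, rfl⟩ := hP; exact hf l
  | algebraMap c => exact S.const c
  | add P Q _ _ hP hQ => exact add_mem hP hQ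
  | mul P Q _ _ hP hQ => exact mul_mem hP hQ

theorem IsRegularMap.isMorphism {f : X → E} (hf : S.IsRegularMap f) :
    IsMorphism S (affineSpace E) f := by
  let _ := S.toTopologicalSpace
  intro U g hg
  have regular_near : ∀ x ∈ f ⁻¹' U, ∃ V g', S.IsRegularOn V g' ∧ x ∈ V ∧ V ⊆ f ⁻¹' U ∧
      ∀ y ∈ V, (g ∘ f) y = g' y := by
    intro x hx
    obtain ⟨P, hP, Q, hQ, hQx, hPQ⟩ := hg (f x) hx
    have hO := isOpen_ne_zero (hf.polyFunctions_comp hQ)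
    refine ⟨{x | (Q ∘ f) x ≠ 0}, fun x => (P ∘ f) x * ((Q ∘ f) x)⁻¹,
      S.mul (S.restrict (hf.polyFunctions_comp hP) hO (Set.subset_univ _))
        (S.inv (S.restrict (hf.polyFunctions_comp hQ) hO (Set.subset_univ _)) fun x hx => hx),
      hQx, fun y hy => (hPQ _ hy).1, fun y hy => ?_⟩
    rw [Function.comp_apply, (hPQ _ hy).2, div_eq_mul_inv]
    rfl
  refine S.glue ?_ fun x hx => ?_
  · rw [isOpen_iff_forall_mem_open]
    intro x hx
    obtain ⟨V, g', hg', hxV, hV, -⟩ := regular_near x hx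
    exact ⟨V, hV, S.isOpen_of_regular hg', hxV⟩
  · obtain ⟨V, g', hg', hxV, -, hgg'⟩ := regular_near x hx
    exact ⟨V, g', hg', hxV, fun y hy _ => hgg' y hy⟩

theorem isMorphism_affineSpace_iff {f : X → E} :
    IsMorphism S (affineSpace E) f ↔ S.IsRegularMap f :=
  ⟨fun h l => h Set.univ l fun _ _ => ⟨l, Algebra.subset_adjoin ⟨l, rfl⟩, 1, one_mem _,
    one_ne_zero, fun y _ => ⟨trivial, (div_one (l y)).symm⟩⟩, IsRegularMap.isMorphism⟩

theorem isRegularMap_of_local {f : X → E} (h : ∀ x, ∃ U : Set X,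
    IsOpen[S.toTopologicalSpace] U ∧ x ∈ U ∧ (S.sub U).IsRegularMap fun y => f y) :
    S.IsRegularMap f :=
  isMorphism_affineSpace_iff.1 <| isMorphism_of_local fun x =>
    (h x).imp fun _ hU => ⟨hU.1, hU.2.1, hU.2.2.isMorphism⟩

theorem IsRegularMap.comp {f : Y → E} (hf : T.IsRegularMap f) {g : X → Y}
    (hg : IsMorphism S T g) : S.IsRegularMap fun x => f (g x) :=
  fun l => hg _ _ (hf l)

theorem IsRegularMap.restrict {f : X → E} (hf : S.IsRegularMap f) (s : Set X) :
    (S.sub s).IsRegularMap fun x => f x :=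
  hf.comp (isMorphism_val s)

theorem isRegularMap_id : (affineSpace E).IsRegularMap (fun x : E => x) :=
  isMorphism_affineSpace_iff.1 IsMorphism.id

theorem isRegularMap_const (c : E) : S.IsRegularMap fun _ => c := fun l => S.const (l c)

theorem IsRegularMap.linearMap_comp {f : X → E} (hf : S.IsRegularMap f) (L : E →ₗ[ℂ] F) :
    S.IsRegularMap fun x => L (f x) :=
  fun l => hf (l ∘ₗ L)

theorem IsRegularMap.add {f g : X → E} (hf : S.IsRegularMap f) (hg : S.IsRegularMap g) :
    S.IsRegularMap fun x => f x + g x := fun l => by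
  simp only [map_add]
  exact add_mem (hf l) (hg l)

theorem IsRegularMap.sub {f g : X → E} (hf : S.IsRegularMap f) (hg : S.IsRegularMap g) :
    S.IsRegularMap fun x => f x - g x := fun l => by
  simp only [map_sub]
  exact sub_mem (hf l) (hg l)

theorem IsRegularMap.smul {c : X → ℂ} {f : X → E} (hc : c ∈ S.globalFunctions)
    (hf : S.IsRegularMap f) : S.IsRegularMap fun x => c x • f x := fun l => by
  simp only [map_smul]
  exact mul_mem hc (hf l)

theorem IsRegularMap.sum {ι : Type*} (s : Finset ι) {f : ι → X → E}
    (hf : ∀ i ∈ s, S.IsRegularMap (f i)) : S.IsRegularMap fun x => ∑ i ∈ s, f i x := fun l => by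
  convert sum_mem (S := S.globalFunctions) fun i hi => hf i hi l using 1
  ext x
  simp only [map_sum, Finset.sum_apply]

theorem isRegularMap_complex_iff {f : X → ℂ} : S.IsRegularMap f ↔ f ∈ S.globalFunctions := by
  refine ⟨fun h => h LinearMap.id, fun h l => ?_⟩
  have : (fun x => l (f x)) = l 1 • f := by
    ext x
    rw [← mul_one (f x), ← smul_eq_mul (f x), map_smul, Pi.smul_apply, smul_eq_mul, mul_comm,
      smul_eq_mul]
  rw [this]
  exact Subalgebra.smul_mem _ h _

theorem IsRegularMap.bilin [FiniteDimensional ℂ E] {f : X → E} {g : X → F}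
    (hf : S.IsRegularMap f) (hg : S.IsRegularMap g) (B : E →ₗ[ℂ] F →ₗ[ℂ] G) :
    S.IsRegularMap fun x => B (f x) (g x) := by
  let b := Module.finBasis ℂ E
  have expand : (fun x => B (f x) (g x)) = fun x => ∑ i, (b.coord i (f x)) • B (b i) (g x) := by
    ext x
    conv_lhs => rw [← b.sum_repr (f x), map_sum, LinearMap.sum_apply]
    simp only [map_smul, LinearMap.smul_apply, Module.Basis.coord_apply]
  rw [expand]
  exact IsRegularMap.sum _ fun i _ => (hg.linearMap_comp (B (b i))).smul (hf (b.coord i))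

theorem IsRegularMap.hom_comp [FiniteDimensional ℂ F] [FiniteDimensional ℂ G]
    {g : X → F →ₗ[ℂ] G} {f : X → E →ₗ[ℂ] F}
    (hg : S.IsRegularMap g) (hf : S.IsRegularMap f) : S.IsRegularMap fun x => g x ∘ₗ f x :=
  hg.bilin hf (LinearMap.llcomp ℂ E F G)

theorem IsRegularMap.hom_apply [FiniteDimensional ℂ E] [FiniteDimensional ℂ F]
    {f : X → E →ₗ[ℂ] F} {g : X → E}
    (hf : S.IsRegularMap f) (hg : S.IsRegularMap g) : S.IsRegularMap fun x => f x (g x) :=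
  hf.bilin hg LinearMap.id

theorem isRegularMap_prod_iff {f : X → E × F} : S.IsRegularMap f ↔
    (S.IsRegularMap fun x => (f x).1) ∧ S.IsRegularMap fun x => (f x).2 := by
  refine ⟨fun h => ⟨h.linearMap_comp (LinearMap.fst ℂ E F),
    h.linearMap_comp (LinearMap.snd ℂ E F)⟩, fun h => ?_⟩
  simpa using
    (h.1.linearMap_comp (LinearMap.inl ℂ E F)).add (h.2.linearMap_comp (LinearMap.inr ℂ E F))

theorem isRegularMap_pi_iff {ι : Type*} [Finite ι] {E : ι → Type*} [∀ i, AddCommGroup (E i)]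
    [∀ i, Module ℂ (E i)] {f : X → ∀ i, E i} :
    S.IsRegularMap f ↔ ∀ i, S.IsRegularMap fun x => f x i := by
  classical
  have := Fintype.ofFinite ι
  refine ⟨fun h i => h.linearMap_comp (LinearMap.proj i), fun h => ?_⟩
  convert IsRegularMap.sum Finset.univ fun i _ => (h i).linearMap_comp (LinearMap.single ℂ E i)
    using 2 with x
  exact (LinearMap.sum_single_apply E (f x)).symm

theorem isRegularMap_hom_iff [FiniteDimensional ℂ E] [FiniteDimensional ℂ F] {f : X → E →ₗ[ℂ] F} :
    S.IsRegularMap f ↔ ∀ v, S.IsRegularMap fun x => f x v := by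
  refine ⟨fun h v => h.hom_apply (isRegularMap_const v), fun h => ?_⟩
  let b := Module.finBasis ℂ E
  have images : S.IsRegularMap fun x i => f x (b i) := isRegularMap_pi_iff.2 fun i => h (b i)
  convert images.linearMap_comp (b.constr ℂ (M' := F)).toLinearMap using 2 with x
  exact (b.constr_self ℂ (f x)).symm

theorem IsRegularMap.hom_prod [FiniteDimensional ℂ E] [FiniteDimensional ℂ F]
    [FiniteDimensional ℂ G] {f : X → E →ₗ[ℂ] F} {g : X → E →ₗ[ℂ] G} (hf : S.IsRegularMap f)
    (hg : S.IsRegularMap g) : S.IsRegularMap fun x => (f x).prod (g x) :=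
  isRegularMap_hom_iff.2 fun v => isRegularMap_prod_iff.2
    ⟨isRegularMap_hom_iff.1 hf v, isRegularMap_hom_iff.1 hg v⟩

theorem IsRegularMap.hom_coprod [FiniteDimensional ℂ E] [FiniteDimensional ℂ F]
    [FiniteDimensional ℂ G] {f : X → E →ₗ[ℂ] G} {g : X → F →ₗ[ℂ] G} (hf : S.IsRegularMap f)
    (hg : S.IsRegularMap g) : S.IsRegularMap fun x => (f x).coprod (g x) :=
  isRegularMap_hom_iff.2 fun v =>
    (isRegularMap_hom_iff.1 hf v.1).add (isRegularMap_hom_iff.1 hg v.2)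

theorem IsRegularMap.hom_pi [FiniteDimensional ℂ E] {ι : Type*} [Finite ι] {F : ι → Type*}
    [∀ i, AddCommGroup (F i)] [∀ i, Module ℂ (F i)] [∀ i, FiniteDimensional ℂ (F i)]
    {f : ∀ i, X → E →ₗ[ℂ] F i} (hf : ∀ i, S.IsRegularMap (f i)) :
    S.IsRegularMap fun x => LinearMap.pi fun i => f i x :=
  isRegularMap_hom_iff.2 fun v => isRegularMap_pi_iff.2 fun i => isRegularMap_hom_iff.1 (hf i) v

end RegularMaps

end SpaceWithFunctions

/-! ### Linear families -/

section LinearAlgebra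

variable {K E F : Type*} [Field K] [AddCommGroup E] [Module K E] [AddCommGroup F] [Module K F]

theorem exists_comp_comp_eq_id_of_le_finrank_range {A : E →ₗ[K] F} {k : ℕ}
    (hk : k ≤ Module.finrank K (LinearMap.range A)) :
    ∃ (r : (Fin k → K) →ₗ[K] E) (ρ : F →ₗ[K] (Fin k → K)), ρ ∘ₗ A ∘ₗ r = LinearMap.id := by
  obtain ⟨b, hb⟩ := exists_linearIndependent_of_le_finrank hk
  choose c hc using fun i => (b i).2
  have hAc : LinearIndependent K (A ∘ c) := by
    rw [show A ∘ c = (LinearMap.range A).subtype ∘ b from funext hc]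
    exact hb.map' _ (Submodule.ker_subtype _)
  obtain ⟨ρ, hρ⟩ := (Fintype.linearCombination K (A ∘ c)).exists_leftInverse_of_injective
    (LinearMap.ker_eq_bot.2 (linearIndependent_iff_injective_fintypeLinearCombination.1 hAc))
  refine ⟨Fintype.linearCombination K c, ρ, ?_⟩
  rw [← hρ]
  congr 1
  ext i
  simp

theorem finrank_le_finrank_range_of_surjective_comp_comp {G : Type*} [AddCommGroup G] [Module K G]
    [FiniteDimensional K E] {A : E →ₗ[K] F} {r : G →ₗ[K] E} {ρ : F →ₗ[K] G}
    (h : Function.Surjective (ρ ∘ₗ A ∘ₗ r)) :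
    Module.finrank K G ≤ Module.finrank K (LinearMap.range A) := by
  have hsurj : Function.Surjective (ρ.domRestrict (LinearMap.range A)) := fun v =>
    (h v).imp' (fun x => ⟨A (r x), LinearMap.mem_range_self A _⟩) fun _ hx => hx
  exact LinearMap.finrank_le_finrank_of_surjective hsurj

end LinearAlgebra

namespace SpaceWithFunctions

section LinearFamilies

variable {X : Type*} {S : SpaceWithFunctions X}
variable {E F G : Type*} [AddCommGroup E] [Module ℂ E] [FiniteDimensional ℂ E]
  [AddCommGroup F] [Module ℂ F] [FiniteDimensional ℂ F]
  [AddCommGroup G] [Module ℂ G] [FiniteDimensional ℂ G]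

theorem isUnit_globalFunctions {f : S.globalFunctions} (h : ∀ x, f.1 x ≠ 0) : IsUnit f :=
  IsUnit.of_mul_eq_one ⟨fun x => (f.1 x)⁻¹, S.inv f.2 fun x _ => h x⟩
    (Subtype.ext (funext fun x => mul_inv_cancel₀ (h x)))

/-- Evaluation at a point, as a ring homomorphism on the regular functions. -/
def evalAt (S : SpaceWithFunctions X) (x : X) : S.globalFunctions →+* ℂ :=
  (Pi.evalRingHom (fun _ => ℂ) x).comp S.globalFunctions.val.toRingHom

theorem IsRegularMap.exists_matrix {n : Type*} [Fintype n] [DecidableEq n]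
    {f : X → E →ₗ[ℂ] E} (hf : S.IsRegularMap f) (b : Module.Basis n ℂ E) :
    ∃ M : Matrix n n S.globalFunctions, ∀ x, f x = Matrix.toLin b b (M.map (S.evalAt x)) := by
  refine ⟨fun i j => ⟨_, isRegularMap_hom_iff.1 hf (b j) (b.coord i)⟩, fun x => ?_⟩
  rw [← Matrix.toLin_toMatrix b b (f x)]
  congr 1
  ext i j
  exact LinearMap.toMatrix_apply b b (f x) i j

omit [FiniteDimensional ℂ E] in
theorem isRegularMap_toLin {n : Type*} [Fintype n] [DecidableEq n] (b : Module.Basis n ℂ E)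
    (M : Matrix n n S.globalFunctions) :
    S.IsRegularMap fun x => Matrix.toLin b b (M.map (S.evalAt x)) := by
  have entries : S.IsRegularMap fun x i j => S.evalAt x (M i j) := isRegularMap_pi_iff.2 fun i =>
    isRegularMap_pi_iff.2 fun j => isRegularMap_complex_iff.2 (M i j).2
  exact (entries.linearMap_comp (Matrix.ofLinearEquiv ℂ).toLinearMap).linearMap_comp
    (Matrix.toLin b b).toLinearMap

omit [FiniteDimensional ℂ E] in
theorem det_toLin_map_evalAt {n : Type*} [Fintype n] [DecidableEq n] (b : Module.Basis n ℂ E)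
    (M : Matrix n n S.globalFunctions) (x : X) :
    LinearMap.det (Matrix.toLin b b (M.map (S.evalAt x))) = M.det.1 x := by
  rw [LinearMap.det_toLin]
  exact ((S.evalAt x).map_det M).symm

theorem isOpen_isUnit {f : X → E →ₗ[ℂ] E} (hf : S.IsRegularMap f) :
    IsOpen[S.toTopologicalSpace] {x | IsUnit (f x)} := by
  obtain ⟨M, hM⟩ := hf.exists_matrix (Module.finBasis ℂ E)
  convert isOpen_ne_zero M.det.2 using 3 with x
  rw [LinearMap.isUnit_iff_isUnit_det, hM, det_toLin_map_evalAt, isUnit_iff_ne_zero]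

-- Cramer's rule, in matrices over the ring of regular functions.
theorem IsRegularMap.ringInverse {f : X → E →ₗ[ℂ] E} (hf : S.IsRegularMap f)
    (h : ∀ x, IsUnit (f x)) : S.IsRegularMap fun x => Ring.inverse (f x) := by
  obtain ⟨M, hM⟩ := hf.exists_matrix (Module.finBasis ℂ E)
  have hdet : IsUnit M.det := isUnit_globalFunctions fun x => by
    rw [← det_toLin_map_evalAt (Module.finBasis ℂ E), ← hM, ← isUnit_iff_ne_zero,
      ← LinearMap.isUnit_iff_isUnit_det]
    exact h x
  convert isRegularMap_toLin (Module.finBasis ℂ E) M⁻¹ using 2 with x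
  have hmul : f x * Matrix.toLin (Module.finBasis ℂ E) (Module.finBasis ℂ E)
      (M⁻¹.map (S.evalAt x)) = 1 := by
    rw [hM, Module.End.mul_eq_comp, ← Matrix.toLin_mul, ← Matrix.map_mul,
      Matrix.mul_nonsing_inv _ hdet, Matrix.map_one _ (map_zero _) (map_one _), Matrix.toLin_one]
    rfl
  rw [← mul_one (Ring.inverse (f x)), ← hmul, ← mul_assoc, Ring.inverse_mul_cancel _ (h x),
    one_mul]

theorem IsRegularMap.exists_local_rightInverse {f : X → E →ₗ[ℂ] F} (hf : S.IsRegularMap f)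
    (hsurj : ∀ x, Function.Surjective (f x)) (x₀ : X) :
    ∃ U : Set X, IsOpen[S.toTopologicalSpace] U ∧ x₀ ∈ U ∧ ∃ s : U → F →ₗ[ℂ] E,
      (S.sub U).IsRegularMap s ∧ ∀ x : U, f x ∘ₗ s x = LinearMap.id := by
  obtain ⟨r, hr⟩ := (f x₀).exists_rightInverse_of_surjective (LinearMap.range_eq_top.2 (hsurj x₀))
  have hfr : S.IsRegularMap fun x => f x ∘ₗ r := hf.hom_comp (isRegularMap_const r)
  refine ⟨{x | IsUnit (f x ∘ₗ r)}, isOpen_isUnit hfr, (congrArg IsUnit hr).mpr isUnit_one,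
    fun x => r ∘ₗ Ring.inverse (f x ∘ₗ r),
    (isRegularMap_const r).hom_comp ((hfr.restrict _).ringInverse fun x => x.2), fun x => ?_⟩
  rw [← LinearMap.comp_assoc]
  exact Ring.mul_inverse_cancel _ x.2

theorem IsRegularMap.of_comp_surjective {f : X → E →ₗ[ℂ] F} (hf : S.IsRegularMap f)
    (hsurj : ∀ x, Function.Surjective (f x)) {h : X → F →ₗ[ℂ] G}
    (hhf : S.IsRegularMap fun x => h x ∘ₗ f x) : S.IsRegularMap h := by
  refine isRegularMap_of_local fun x₀ => ?_
  obtain ⟨U, hU, hx₀, s, hs, hfs⟩ := hf.exists_local_rightInverse hsurj x₀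
  refine ⟨U, hU, hx₀, ?_⟩
  convert (hhf.restrict U).hom_comp hs using 2 with x
  rw [LinearMap.comp_assoc, hfs, LinearMap.comp_id]

omit [FiniteDimensional ℂ E] in
theorem IsRegularMap.of_injective_comp {f : X → F →ₗ[ℂ] G} (hf : S.IsRegularMap f)
    (hinj : ∀ x, Function.Injective (f x)) {h : X → E →ₗ[ℂ] F}
    (hfh : S.IsRegularMap fun x => f x ∘ₗ h x) : S.IsRegularMap h := by
  refine isRegularMap_of_local fun x₀ => ?_
  obtain ⟨l, hl⟩ := (f x₀).exists_leftInverse_of_injective (LinearMap.ker_eq_bot.2 (hinj x₀))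
  have hlf : S.IsRegularMap fun x => l ∘ₗ f x := (isRegularMap_const l).hom_comp hf
  let U := {x | IsUnit (l ∘ₗ f x)}
  refine ⟨U, isOpen_isUnit hlf, (congrArg IsUnit hl).mpr isUnit_one, ?_⟩
  have hlfh := (isRegularMap_const l).hom_comp (hfh.restrict U)
  convert ((hlf.restrict U).ringInverse fun x => x.2).hom_comp hlfh using 2 with x
  have := Ring.inverse_mul_cancel _ x.2
  rw [Module.End.mul_eq_comp] at this
  rw [← LinearMap.comp_assoc (h x), ← LinearMap.comp_assoc (h x), this, Module.End.one_eq_id,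
    LinearMap.id_comp]

theorem isOpen_le_finrank_range {f : X → E →ₗ[ℂ] F} (hf : S.IsRegularMap f) (k : ℕ) :
    IsOpen[S.toTopologicalSpace] {x | k ≤ Module.finrank ℂ (LinearMap.range (f x))} := by
  let _ := S.toTopologicalSpace
  rw [isOpen_iff_forall_mem_open]
  intro x hx
  obtain ⟨r, ρ, h⟩ := exists_comp_comp_eq_id_of_le_finrank_range hx
  refine ⟨{y | IsUnit (ρ ∘ₗ f y ∘ₗ r)}, fun y hy => ?_,
    isOpen_isUnit ((isRegularMap_const ρ).hom_comp (hf.hom_comp (isRegularMap_const r))),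
    (congrArg IsUnit h).mpr isUnit_one⟩
  simpa using finrank_le_finrank_range_of_surjective_comp_comp
    ((Module.End.isUnit_iff _).1 hy).2

theorem isOpen_surjective {f : X → E →ₗ[ℂ] F} (hf : S.IsRegularMap f) :
    IsOpen[S.toTopologicalSpace] {x | Function.Surjective (f x)} := by
  convert isOpen_le_finrank_range hf (Module.finrank ℂ F) using 3 with x
  rw [← LinearMap.range_eq_top]
  exact ⟨fun h => by rw [h, finrank_top],
    fun h => Submodule.eq_top_of_finrank_eq ((Submodule.finrank_le _).antisymm h)⟩

theorem isOpen_injective {f : X → E →ₗ[ℂ] F} (hf : S.IsRegularMap f) :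
    IsOpen[S.toTopologicalSpace] {x | Function.Injective (f x)} := by
  convert isOpen_le_finrank_range hf (Module.finrank ℂ E) using 3 with x
  rw [← LinearMap.ker_eq_bot, ← Submodule.finrank_eq_zero (R := ℂ),
    ← (f x).finrank_range_add_finrank_ker]
  lia

end LinearFamilies

end SpaceWithFunctions

/-! ### Grassmannians -/

theorem comap_eq_map_sup_range {K E F : Type*} [Ring K] [AddCommGroup E] [Module K E]
    [AddCommGroup F] [Module K F] {p : E →ₗ[K] F} {s : F →ₗ[K] E} (hps : p ∘ₗ s = LinearMap.id)
    (V : Submodule K F) :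
    V.comap p = V.map s ⊔ LinearMap.range (LinearMap.id - s ∘ₗ p) := by
  have hps' (y : F) : p (s y) = y := LinearMap.congr_fun hps y
  refine le_antisymm (fun x hx => ?_) (sup_le ?_ ?_)
  · rw [← add_sub_cancel (s (p x)) x]
    exact Submodule.add_mem_sup (Submodule.mem_map_of_mem hx) ⟨x, rfl⟩
  · rintro _ ⟨y, hy, rfl⟩
    simpa [hps'] using hy
  · rintro _ ⟨x, rfl⟩
    simp [hps']

section BigCells

variable {E : Type*} [AddCommGroup E] [Module ℂ E] {d : ℕ}

theorem range_linearCombination_frame (b : frames d E) :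
    LinearMap.range (Fintype.linearCombination ℂ b.1) = (frameSpan d E b).1 :=
  Fintype.range_linearCombination ..

/-- The big cell of the Grassmannian belonging to `ρ`: the subspaces on which `ρ` restricts to an
isomorphism, that is, the complements of the kernel of `ρ` if `ρ` is surjective. -/
def bigCell (ρ : E →ₗ[ℂ] (Fin d → ℂ)) : Set (Gr d E) :=
  {X | Function.Bijective (ρ.domRestrict X.1)}

/-- The inverse of the isomorphism `X ≃ ℂᵈ` induced by `ρ`, as a map to the ambient space. -/
noncomputable def cellSection (ρ : E →ₗ[ℂ] (Fin d → ℂ)) (X : bigCell ρ) : (Fin d → ℂ) →ₗ[ℂ] E :=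
  X.1.1.subtype ∘ₗ (LinearEquiv.ofBijective _ X.2).symm.toLinearMap

variable {ρ : E →ₗ[ℂ] (Fin d → ℂ)}

theorem comp_cellSection (X : bigCell ρ) : ρ ∘ₗ cellSection ρ X = LinearMap.id :=
  LinearMap.ext (LinearEquiv.ofBijective _ X.2).apply_symm_apply

theorem cellSection_apply_of_mem (X : bigCell ρ) {x : E} (hx : x ∈ X.1.1) :
    cellSection ρ X (ρ x) = x :=
  congrArg Subtype.val ((LinearEquiv.ofBijective _ X.2).symm_apply_apply ⟨x, hx⟩)

theorem range_cellSection (X : bigCell ρ) : LinearMap.range (cellSection ρ X) = X.1.1 := by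
  rw [cellSection, LinearMap.range_comp, LinearEquiv.range, Submodule.map_subtype_top]

theorem mem_bigCell_iff_surjective [FiniteDimensional ℂ E] {X : Gr d E} :
    X ∈ bigCell ρ ↔ Function.Surjective (ρ.domRestrict X.1) :=
  ⟨fun h => h.2, fun h => ⟨(LinearMap.injective_iff_surjective_of_finrank_eq_finrank
    (by rw [X.2, Module.finrank_fin_fun])).2 h, h⟩⟩

theorem exists_mem_bigCell [FiniteDimensional ℂ E] (X : Gr d E) :
    ∃ ρ : E →ₗ[ℂ] (Fin d → ℂ), X ∈ bigCell ρ := by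
  let e : X.1 ≃ₗ[ℂ] (Fin d → ℂ) :=
    LinearEquiv.ofFinrankEq _ _ (by rw [X.2, Module.finrank_fin_fun])
  obtain ⟨ρ, hρ⟩ := LinearMap.exists_extend (e : X.1 →ₗ[ℂ] (Fin d → ℂ))
  refine ⟨ρ, ?_⟩
  change Function.Bijective (ρ ∘ₗ X.1.subtype)
  exact hρ ▸ e.bijective

end BigCells

namespace SpaceWithFunctions

section Grassmannians

variable {X : Type*} {S : SpaceWithFunctions X}
variable {E F G : Type*} [AddCommGroup E] [Module ℂ E] [FiniteDimensional ℂ E]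
  [AddCommGroup F] [Module ℂ F] [FiniteDimensional ℂ F]
  [AddCommGroup G] [Module ℂ G] [FiniteDimensional ℂ G] {d d' : ℕ}

theorem IsRegularMap.linearCombination {ι : Type*} [Fintype ι] {b : X → ι → E}
    (hb : S.IsRegularMap b) : S.IsRegularMap fun x => Fintype.linearCombination ℂ (b x) :=
  isRegularMap_hom_iff.2 fun v => by
    simp only [Fintype.linearCombination_apply]
    exact IsRegularMap.sum _ fun i _ =>
      (isRegularMap_pi_iff.1 hb i).linearMap_comp (v i • LinearMap.id)

theorem isOpen_linearIndependent {b : X → Fin d → E} (hb : S.IsRegularMap b) :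
    IsOpen[S.toTopologicalSpace] {x | LinearIndependent ℂ (b x)} := by
  simp only [linearIndependent_iff_injective_fintypeLinearCombination]
  exact isOpen_injective hb.linearCombination

theorem isMorphism_grassmannian_of_range {φ : X → Gr d E} {B : X → G →ₗ[ℂ] E}
    (hB : S.IsRegularMap B) (h : ∀ x, LinearMap.range (B x) = (φ x).1) :
    IsMorphism S (grassmannian d E) φ := by
  refine isMorphism_of_local fun x₀ => ?_
  obtain ⟨r, ρ, hr⟩ := exists_comp_comp_eq_id_of_le_finrank_range (A := B x₀) (k := d)
    (by rw [h, (φ x₀).2])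
  let c (x : X) (i : Fin d) : E := B x (r (Pi.single i 1))
  have hc : S.IsRegularMap c := isRegularMap_pi_iff.2 fun i => isRegularMap_hom_iff.1 hB _
  have independent_at : LinearIndependent ℂ (c x₀) := by
    refine LinearIndependent.of_comp (ρ ∘ₗ LinearMap.id) ?_
    convert (Pi.basisFun ℂ (Fin d)).linearIndependent using 1
    ext1 i
    simpa [c] using LinearMap.congr_fun hr (Pi.single i 1)
  refine ⟨{x | LinearIndependent ℂ (c x)}, isOpen_linearIndependent hc, independent_at, ?_⟩
  have frame : IsMorphism (S.sub {x | LinearIndependent ℂ (c x)})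
      ((affineSpace (Fin d → E)).sub (frames d E)) fun x => ⟨c x, x.2⟩ :=
    isMorphism_sub_iff.2 (hc.restrict _).isMorphism
  have spanned : IsMorphism (S.sub {x | LinearIndependent ℂ (c x)}) (grassmannian d E)
      fun x => frameSpan d E ⟨c x, x.2⟩ := (isMorphism_coinduced (frameSpan d E)).comp frame
  convert spanned using 2 with x
  refine Subtype.ext (Submodule.eq_of_le_of_finrank_eq ?_ ?_).symm
  · rw [← h]
    refine Submodule.span_le.2 ?_
    rintro _ ⟨i, rfl⟩
    exact ⟨_, rfl⟩
  · exact (frameSpan d E ⟨c x, x.2⟩).2.trans (φ x).2.symm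

theorem isOpen_bigCell (ρ : E →ₗ[ℂ] (Fin d → ℂ)) :
    IsOpen[(grassmannian d E).toTopologicalSpace] (bigCell ρ) := by
  change IsOpen[((affineSpace (Fin d → E)).sub (frames d E)).toTopologicalSpace]
    (frameSpan d E ⁻¹' bigCell ρ)
  have hρ := (isRegularMap_const ρ).hom_comp
    ((isRegularMap_id (E := Fin d → E)).restrict (frames d E)).linearCombination
  convert isOpen_surjective hρ using 1
  ext b
  rw [Set.mem_preimage, mem_bigCell_iff_surjective, ← LinearMap.range_eq_top,
    LinearMap.range_domRestrict, ← range_linearCombination_frame, ← LinearMap.range_comp,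
    LinearMap.range_eq_top]
  rfl

theorem isRegularMap_cellSection (ρ : E →ₗ[ℂ] (Fin d → ℂ)) :
    ((grassmannian d E).sub (bigCell ρ)).IsRegularMap (cellSection ρ) := by
  have hb := ((isRegularMap_id (E := Fin d → E)).restrict (frames d E)).linearCombination.restrict
    (frameSpan d E ⁻¹' bigCell ρ)
  have pulled_back : (((affineSpace (Fin d → E)).sub (frames d E)).sub
      (frameSpan d E ⁻¹' bigCell ρ)).IsRegularMap
      fun b => cellSection ρ ⟨frameSpan d E b, b.2⟩ := by
    refine IsRegularMap.of_comp_surjective ((isRegularMap_const ρ).hom_comp hb) (fun b => ?_) ?_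
    · rw [← LinearMap.range_eq_top, LinearMap.range_comp, range_linearCombination_frame,
        ← LinearMap.range_domRestrict, LinearMap.range_eq_top]
      exact b.2.2
    · convert hb using 2 with b
      refine LinearMap.ext fun c => cellSection_apply_of_mem _ ?_
      rw [← range_linearCombination_frame]
      exact LinearMap.mem_range_self _ c
  exact isMorphism_affineSpace_iff.1
    (isMorphism_sub_coinduced (S := (affineSpace (Fin d → E)).sub (frames d E))
      (isOpen_bigCell ρ) pulled_back.isMorphism)

theorem exists_local_frame {φ : X → Gr d E} (hφ : IsMorphism S (grassmannian d E) φ) (x₀ : X) :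
    ∃ U : Set X, IsOpen[S.toTopologicalSpace] U ∧ x₀ ∈ U ∧ ∃ b : U → (Fin d → ℂ) →ₗ[ℂ] E,
      (S.sub U).IsRegularMap b ∧ ∀ x, LinearMap.range (b x) = (φ x).1 := by
  obtain ⟨ρ, hρ⟩ := exists_mem_bigCell (φ x₀)
  refine ⟨φ ⁻¹' bigCell ρ, hφ.isOpen_preimage (isOpen_bigCell ρ), hρ,
    fun x => cellSection ρ ⟨φ x, x.2⟩, (isRegularMap_cellSection ρ).comp ?_,
    fun x => range_cellSection _⟩
  exact isMorphism_sub_iff.2 (hφ.comp (isMorphism_val _))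

theorem isMorphism_grassmannian_map_sup {φ : X → Gr d E} {ψ : X → Gr d' F}
    (hφ : IsMorphism S (grassmannian d E) φ) {L : X → E →ₗ[ℂ] F} (hL : S.IsRegularMap L)
    {M : X → G →ₗ[ℂ] F} (hM : S.IsRegularMap M)
    (h : ∀ x, (ψ x).1 = (φ x).1.map (L x) ⊔ LinearMap.range (M x)) :
    IsMorphism S (grassmannian d' F) ψ := by
  refine isMorphism_of_local fun x₀ => ?_
  obtain ⟨U, hU, hx₀, b, hb, hbφ⟩ := exists_local_frame hφ x₀
  refine ⟨U, hU, hx₀, isMorphism_grassmannian_of_range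
    (((hL.restrict U).hom_comp hb).hom_coprod (hM.restrict U)) fun x => ?_⟩
  rw [LinearMap.range_coprod, LinearMap.range_comp, hbφ, h]

theorem isMorphism_grassmannian_map {φ : X → Gr d E} {ψ : X → Gr d' F}
    (hφ : IsMorphism S (grassmannian d E) φ) {L : X → E →ₗ[ℂ] F} (hL : S.IsRegularMap L)
    (h : ∀ x, (ψ x).1 = (φ x).1.map (L x)) : IsMorphism S (grassmannian d' F) ψ :=
  isMorphism_grassmannian_map_sup (G := F) hφ hL (isRegularMap_const 0) (by simpa using h)

theorem isMorphism_grassmannian_comap {φ : X → Gr d F} {ψ : X → Gr d' E}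
    (hφ : IsMorphism S (grassmannian d F) φ) {p : X → E →ₗ[ℂ] F} (hp : S.IsRegularMap p)
    (hsurj : ∀ x, Function.Surjective (p x)) (h : ∀ x, (ψ x).1 = (φ x).1.comap (p x)) :
    IsMorphism S (grassmannian d' E) ψ := by
  refine isMorphism_of_local fun x₀ => ?_
  obtain ⟨U, hU, hx₀, s, hs, hps⟩ := IsRegularMap.exists_local_rightInverse hp hsurj x₀
  exact ⟨U, hU, hx₀, isMorphism_grassmannian_map_sup (hφ.comp (isMorphism_val U)) hs
    ((isRegularMap_const LinearMap.id).sub (hs.hom_comp (hp.restrict U)))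
    fun x => (h x).trans (comap_eq_map_sup_range (hps x) _)⟩

end Grassmannians

end SpaceWithFunctions

/-! ### Open immersions and nonsingularity -/

namespace SpaceWithFunctions

section LocalRings

variable {X Y : Type*} {S : SpaceWithFunctions X} {T : SpaceWithFunctions Y}

theorem germ_eq_iff {x : X} {f g : X → ℂ} :
    (f : Filter.Germ (@nhds X S.toTopologicalSpace x) ℂ) = g ↔
      ∃ U, IsOpen[S.toTopologicalSpace] U ∧ x ∈ U ∧ ∀ y ∈ U, f y = g y := by
  let _ := S.toTopologicalSpace
  rw [Filter.Germ.coe_eq, Filter.EventuallyEq, eventually_nhds_iff]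
  exact exists_congr fun U => and_rotate

/-- An open immersion: a morphism that is open and induces isomorphisms on local rings. -/
def IsOpenImmersion (S : SpaceWithFunctions X) (T : SpaceWithFunctions Y) (f : X → Y) : Prop :=
  IsMorphism S T f ∧ ∀ U g, S.IsRegularOn U g → ∃ g', T.IsRegularOn (f '' U) g' ∧
    ∀ x ∈ U, g' (f x) = g x

theorem isOpenImmersion_val {s : Set X} (hs : IsOpen[S.toTopologicalSpace] s) :
    IsOpenImmersion (S.sub s) S Subtype.val := by
  classical
  refine ⟨isMorphism_val s, fun U g hg =>
    ⟨fun x => if h : x ∈ s then g ⟨x, h⟩ else 0, (isRegularOn_sub_iff hs fun x _ => ?_).1 hg, ?_⟩⟩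
  · rw [dif_pos x.2]
  · exact fun x _ => dif_pos x.2

theorem isOpenImmersion_of_isIsomorphism {e : X ≃ Y} (he : IsIsomorphism S T e) :
    IsOpenImmersion S T e := by
  refine ⟨he.1, fun U g hg => ⟨g ∘ e.symm, ?_, fun x _ => congrArg g (e.symm_apply_apply x)⟩⟩
  rw [e.image_eq_preimage_symm]
  exact he.2 U g hg

theorem IsOpenImmersion.isOpen_image {f : X → Y} (hf : IsOpenImmersion S T f) {U : Set X}
    (hU : IsOpen[S.toTopologicalSpace] U) : IsOpen[T.toTopologicalSpace] (f '' U) := by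
  obtain ⟨_, hg', -⟩ := hf.2 U _ (S.restrict (S.const 0) hU (Set.subset_univ U))
  exact T.isOpen_of_regular hg'

/-- The homomorphism of local rings that pulls back germs along a morphism. -/
noncomputable def localRingMap {f : X → Y} (hf : IsMorphism S T f) (x : X) :
    T.localRing (f x) →+* S.localRing x where
  toFun a := ⟨a.1.compTendsto f (hf.tendsto x), by
    obtain ⟨_, U, g, hg, hx, rfl⟩ := a
    exact ⟨_, _, hf U g hg, hx, rfl⟩⟩
  map_one' := rfl
  map_zero' := rfl
  map_mul' := by
    rintro ⟨_, U, g, hg, hx, rfl⟩ ⟨_, V, h, hh, hx', rfl⟩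
    rfl
  map_add' := by
    rintro ⟨_, U, g, hg, hx, rfl⟩ ⟨_, V, h, hh, hx', rfl⟩
    rfl

theorem IsOpenImmersion.bijective_localRingMap {f : X → Y} (hf : IsOpenImmersion S T f) (x : X) :
    Function.Bijective (localRingMap hf.1 x) := by
  constructor
  · rintro ⟨_, U, g, hg, hx, rfl⟩ ⟨_, V, h, hh, hx', rfl⟩ heq
    obtain ⟨N, hN, hxN, hgh⟩ := germ_eq_iff.1 (congrArg Subtype.val heq)
    exact Subtype.ext (germ_eq_iff.2
      ⟨f '' N, hf.isOpen_image hN, ⟨x, hxN, rfl⟩, Set.forall_mem_image.2 hgh⟩)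
  · rintro ⟨_, U, g, hg, hx, rfl⟩
    obtain ⟨g', hg', h⟩ := hf.2 U g hg
    exact ⟨⟨_, _, g', hg', ⟨x, hx, rfl⟩, rfl⟩, Subtype.ext
      (germ_eq_iff.2 ⟨U, S.isOpen_of_regular hg, hx, h⟩)⟩

theorem IsOpenImmersion.isRegularLocalRing_iff {f : X → Y} (hf : IsOpenImmersion S T f) (x : X) :
    IsRegularLocalRing (T.localRing (f x)) ↔ IsRegularLocalRing (S.localRing x) := by
  let e := RingEquiv.ofBijective _ (hf.bijective_localRingMap x)
  exact ⟨fun _ => .of_ringEquiv e, fun _ => .of_ringEquiv e.symm⟩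

theorem IsOpenImmersion.isNonsingular {f : X → Y} (hf : IsOpenImmersion S T f)
    (h : T.IsNonsingular) : S.IsNonsingular :=
  fun x => (hf.isRegularLocalRing_iff x).1 (h _)

theorem isNonsingular_of_local (h : ∀ x, ∃ U : Set X, IsOpen[S.toTopologicalSpace] U ∧ x ∈ U ∧
    (S.sub U).IsNonsingular) : S.IsNonsingular := by
  intro x
  obtain ⟨U, hU, hx, hreg⟩ := h x
  exact ((isOpenImmersion_val hU).isRegularLocalRing_iff ⟨x, hx⟩).2 (hreg ⟨x, hx⟩)

end LocalRings

section AffineSpaces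

variable {ι E : Type*} [AddCommGroup E] [Module ℂ E]

theorem polyFunctions_eq_range_aeval [Finite ι] (b : Module.Basis ι ℂ E) :
    polyFunctions E = (MvPolynomial.aeval fun i x => b.coord i x).range := by
  have := Fintype.ofFinite ι
  rw [← Algebra.adjoin_range_eq_range_aeval]
  refine le_antisymm (Algebra.adjoin_le ?_) (Algebra.adjoin_mono ?_)
  · rintro _ ⟨l, rfl⟩
    change ⇑l ∈ _
    rw [← b.sum_dual_apply_smul_coord l, LinearMap.coe_sum]
    exact sum_mem fun i _ =>
      Subalgebra.smul_mem _ (Algebra.subset_adjoin (Set.mem_range_self i)) (l (b i))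
  · rintro _ ⟨i, rfl⟩
    exact ⟨b.coord i, rfl⟩

theorem mem_polyFunctions_iff [Finite ι] (b : Module.Basis ι ℂ E) {f : E → ℂ} :
    f ∈ polyFunctions E ↔
      ∃ p : MvPolynomial ι ℂ, f = fun x => MvPolynomial.eval (b.repr x) p := by
  rw [polyFunctions_eq_range_aeval b, AlgHom.mem_range]
  refine exists_congr fun p => eq_comm.trans (Eq.congr_right ?_)
  ext x
  exact (MvPolynomial.comp_aeval_apply (fun i x => b.coord i x) (Pi.evalAlgHom ℂ _ x) p).trans
    (DFunLike.congr_fun (MvPolynomial.coe_aeval_eq_eval _) p)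

theorem polyFunctions_mem_globalFunctions {P : E → ℂ} (hP : P ∈ polyFunctions E) :
    P ∈ (affineSpace E).globalFunctions :=
  isRegularMap_id.polyFunctions_comp hP

/-- The germ at `x` of a polynomial in the coordinates with respect to a basis. -/
noncomputable def polyGerm [Finite ι] (b : Module.Basis ι ℂ E) (x : E) :
    MvPolynomial ι ℂ →+* (affineSpace E).localRing x where
  toFun p := ⟨((fun y => MvPolynomial.eval (b.repr y) p : E → ℂ) : Filter.Germ _ ℂ), Set.univ, _,
    polyFunctions_mem_globalFunctions ((mem_polyFunctions_iff b).2 ⟨p, rfl⟩), trivial, rfl⟩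
  map_one' := Subtype.ext (by simp only [map_one]; rfl)
  map_zero' := Subtype.ext (by simp only [map_zero]; rfl)
  map_add' p q := Subtype.ext (by simp only [map_add]; rfl)
  map_mul' p q := Subtype.ext (by simp only [map_mul]; rfl)

theorem isLocalization_polyGerm [Finite ι] (b : Module.Basis ι ℂ E) (x : E) :
    let _ := (polyGerm b x).toAlgebra
    let _ := RingHom.ker_isPrime (MvPolynomial.eval (b.repr x))
    IsLocalization (RingHom.ker (MvPolynomial.eval (b.repr x))).primeCompl
      ((affineSpace E).localRing x) := by
  intro _ _
  have regular (q : MvPolynomial ι ℂ) := polyFunctions_mem_globalFunctions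
    ((mem_polyFunctions_iff b).2 ⟨q, rfl⟩)
  refine ⟨?_, ?_, ?_⟩
  · rintro ⟨q, hq : MvPolynomial.eval (b.repr x) q ≠ 0⟩
    have hO := isOpen_ne_zero (regular q)
    refine IsUnit.of_mul_eq_one
      ⟨((fun y => (MvPolynomial.eval (b.repr y) q)⁻¹ : E → ℂ) : Filter.Germ _ ℂ), _, _,
        (affineSpace E).inv ((affineSpace E).restrict (regular q) hO (Set.subset_univ _))
          (fun _ h => h), hq, rfl⟩ ?_
    exact Subtype.ext (germ_eq_iff.2 ⟨_, hO, hq, fun y hy => mul_inv_cancel₀ hy⟩)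
  · rintro ⟨_, U, f, hf, hxU, rfl⟩
    obtain ⟨p, hp, q, hq, hqx, hf⟩ := hf x hxU
    obtain ⟨p, rfl⟩ := (mem_polyFunctions_iff b).1 hp
    obtain ⟨q, rfl⟩ := (mem_polyFunctions_iff b).1 hq
    refine ⟨(p, ⟨q, hqx⟩), Subtype.ext (germ_eq_iff.2
      ⟨_, isOpen_ne_zero (regular q), hqx, fun y hy => ?_⟩)⟩
    change f y * MvPolynomial.eval (b.repr y) q = MvPolynomial.eval (b.repr y) p
    rw [(hf y hy).2, div_mul_cancel₀ _ hy]
  · intro p q hpq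
    obtain ⟨U, hU, hxU, h⟩ := germ_eq_iff.1 (congrArg Subtype.val hpq)
    obtain ⟨r, hr, hrx, hrU⟩ := hU x hxU
    obtain ⟨r, rfl⟩ := (mem_polyFunctions_iff b).1 hr
    refine ⟨⟨r, hrx⟩, MvPolynomial.funext fun y => ?_⟩
    obtain ⟨y, rfl⟩ := b.equivFun.surjective y
    by_cases hy : MvPolynomial.eval (b.repr y) r = 0
    · simp [hy]
    · simpa using Or.inl (h y (hrU y hy))

theorem isNonsingular_affineSpace [FiniteDimensional ℂ E] : (affineSpace E).IsNonsingular := by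
  intro x
  let b := Module.finBasis ℂ E
  let P := RingHom.ker (MvPolynomial.eval (b.repr x))
  have := RingHom.ker_isPrime (MvPolynomial.eval (b.repr x))
  let _ := (polyGerm b x).toAlgebra
  have := isLocalization_polyGerm b x
  exact .of_ringEquiv (IsLocalization.algEquiv P.primeCompl (Localization.AtPrime P)
    ((affineSpace E).localRing x)).toRingEquiv

theorem affineSpace_inter_nonempty [FiniteDimensional ℂ E] {U V : Set E}
    (hU : IsOpen[(affineSpace E).toTopologicalSpace] U)
    (hV : IsOpen[(affineSpace E).toTopologicalSpace] V) (hU' : U.Nonempty) (hV' : V.Nonempty) :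
    (U ∩ V).Nonempty := by
  let b := Module.finBasis ℂ E
  obtain ⟨x, hx⟩ := hU'
  obtain ⟨z, hz⟩ := hV'
  obtain ⟨q, hq, hqx, hqU⟩ := hU x hx
  obtain ⟨r, hr, hrz, hrV⟩ := hV z hz
  obtain ⟨q, rfl⟩ := (mem_polyFunctions_iff b).1 hq
  obtain ⟨r, rfl⟩ := (mem_polyFunctions_iff b).1 hr
  have hqr : q * r ≠ 0 :=
    mul_ne_zero (by rintro rfl; exact hqx (map_zero _)) (by rintro rfl; exact hrz (map_zero _))
  obtain ⟨y, hy⟩ : ∃ y, MvPolynomial.eval (b.repr y) (q * r) ≠ 0 := by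
    by_contra! h
    exact hqr (MvPolynomial.funext (b.equivFun.surjective.forall.2 fun y => (h y).trans
      (map_zero _).symm))
  rw [map_mul] at hy
  exact ⟨y, hqU y (left_ne_zero_of_mul hy), hrV y (right_ne_zero_of_mul hy)⟩

theorem isIrred_of_surjective [FiniteDimensional ℂ E] {O : Set E}
    (hO : IsOpen[(affineSpace E).toTopologicalSpace] O) (hO' : O.Nonempty) {X : Type*}
    {S : SpaceWithFunctions X} {f : O → X} (hf : IsMorphism ((affineSpace E).sub O) S f)
    (hsurj : Function.Surjective f) : S.IsIrred := by
  let _ := ((affineSpace E).sub O).toTopologicalSpace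
  let _ := S.toTopologicalSpace
  have hcont : Continuous f := ⟨fun _ hU => hf.isOpen_preimage hU⟩
  have : PreirreducibleSpace O := ⟨fun U V hU hV hU' hV' => by
    rw [Set.univ_inter] at hU' hV' ⊢
    have := affineSpace_inter_nonempty (isOpen_image_val hO hU) (isOpen_image_val hO hV)
      (hU'.image _) (hV'.image _)
    rwa [← Set.image_inter Subtype.val_injective, Set.image_nonempty] at this⟩
  have : IrreducibleSpace O := { toNonempty := hO'.to_subtype }
  exact hsurj.irreducibleSpace hcont

end AffineSpaces

end SpaceWithFunctions

/-! ### Rank factorizations of representations -/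

section RankFactorization

variable {K E F G : Type*} [Field K] [AddCommGroup E] [Module K E] [AddCommGroup F] [Module K F]
  [AddCommGroup G] [Module K G]

theorem exists_comp_eq_id_of_finrank_le [FiniteDimensional K E] [FiniteDimensional K F]
    (h : Module.finrank K E ≤ Module.finrank K F) :
    ∃ (j : E →ₗ[K] F) (ρ : F →ₗ[K] E), ρ ∘ₗ j = LinearMap.id := by
  obtain ⟨j, hj⟩ := finrank_le_iff_exists_linearMap.1 h
  exact ⟨j, j.exists_leftInverse_of_injective (LinearMap.ker_eq_bot.2 hj)⟩

theorem exists_split_rank_factorization [FiniteDimensional K E] [FiniteDimensional K G]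
    {A : E →ₗ[K] F} (h : Module.finrank K (LinearMap.range A) = Module.finrank K G) :
    ∃ (j : G →ₗ[K] F) (ρ : F →ₗ[K] G) (q : E →ₗ[K] G) (σ : G →ₗ[K] E),
      ρ ∘ₗ j = LinearMap.id ∧ q ∘ₗ σ = LinearMap.id ∧ j ∘ₗ q = A := by
  let φ : LinearMap.range A ≃ₗ[K] G := LinearEquiv.ofFinrankEq _ _ h
  let j : G →ₗ[K] F := (LinearMap.range A).subtype ∘ₗ φ.symm.toLinearMap
  let q : E →ₗ[K] G := φ.toLinearMap ∘ₗ A.rangeRestrict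
  obtain ⟨ρ, hρ⟩ := j.exists_leftInverse_of_injective
    (LinearMap.ker_eq_bot.2 ((Submodule.subtype_injective _).comp φ.symm.injective))
  obtain ⟨σ, hσ⟩ := q.exists_rightInverse_of_surjective
    (LinearMap.range_eq_top.2 (φ.surjective.comp A.surjective_rangeRestrict))
  exact ⟨j, ρ, q, σ, hρ, hσ, LinearMap.ext fun x => by simp [j, q]⟩

theorem finrank_range_comp_comp {E' F' : Type*} [AddCommGroup E'] [Module K E'] [AddCommGroup F']
    [Module K F'] {j : F →ₗ[K] F'} (hj : Function.Injective j) (A : E →ₗ[K] F) {q : E' →ₗ[K] E}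
    (hq : Function.Surjective q) :
    Module.finrank K (LinearMap.range (j ∘ₗ A ∘ₗ q)) = Module.finrank K (LinearMap.range A) := by
  rw [← LinearMap.comp_assoc, LinearMap.range_comp_of_range_eq_top _ (LinearMap.range_eq_top.2 hq),
    LinearMap.range_comp]
  exact (Submodule.equivMapOfInjective j hj _).finrank_eq.symm

end RankFactorization

section Representations

open SpaceWithFunctions

variable {X I₀ I₁ : Type*} {S : SpaceWithFunctions X} {Ω : I₁ → I₀ → Type*}
  {u w w' : I₀ ⊕ I₁ → ℕ}

section Regular

variable [Finite I₀] {e : X → RepSpace Ω w w'}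

theorem isRegularMap_repSpace_iff [Finite I₁] [∀ β α, Finite (Ω β α)] : S.IsRegularMap e ↔
    (∀ α, S.IsRegularMap fun x => (e x).1 α) ∧ (∀ β, S.IsRegularMap fun x => (e x).2.1 β) ∧
      ∀ β α h, S.IsRegularMap fun x => (e x).2.2 β α h := by
  simp only [isRegularMap_prod_iff, isRegularMap_pi_iff (f := fun x => (e x).1),
    isRegularMap_pi_iff (f := fun x => (e x).2.1), isRegularMap_pi_iff (f := fun x => (e x).2.2)]
  refine and_congr_right fun _ => and_congr_right fun _ => forall_congr' fun β => ?_
  exact isRegularMap_pi_iff.trans (forall_congr' fun α => isRegularMap_pi_iff)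

theorem IsRegularMap.sinkMap [Fintype I₁] [∀ β α, Fintype (Ω β α)] (he : S.IsRegularMap e)
    (α : I₀) : S.IsRegularMap fun x => sinkMap (e x) α :=
  have ⟨h₀, _, h⟩ := isRegularMap_repSpace_iff.1 he
  IsRegularMap.hom_coprod (h₀ α) (IsRegularMap.sum _ fun k _ =>
    IsRegularMap.hom_comp (h k.1 α k.2) (isRegularMap_const _))

theorem IsRegularMap.sourceMap [Finite I₁] [∀ β α, Finite (Ω β α)] (he : S.IsRegularMap e)
    (β : I₁) : S.IsRegularMap fun x => sourceMap (e x) β :=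
  have ⟨_, h₁, h⟩ := isRegularMap_repSpace_iff.1 he
  IsRegularMap.hom_prod (h₁ β) (IsRegularMap.hom_pi fun k => h β k.1 k.2)

theorem isOpen_le_vertexRank [Fintype I₁] [∀ β α, Fintype (Ω β α)] (he : S.IsRegularMap e)
    (u : I₀ ⊕ I₁ → ℕ) : IsOpen[S.toTopologicalSpace] {x | ∀ i, u i ≤ vertexRank (e x) i} := by
  let _ := S.toTopologicalSpace
  simp only [Set.ofPred_forall]
  refine isOpen_iInter_of_finite (Sum.rec (fun α => ?_) fun β => ?_)
  · exact isOpen_le_finrank_range (IsRegularMap.sinkMap he α) _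
  · exact isOpen_le_finrank_range (IsRegularMap.sourceMap he β) _

end Regular

/-- The representation obtained from `e` by composing with linear maps `j` out of the spaces at
the sinks and `q` into the spaces at the sources; the spaces `W'_i` are left unchanged. -/
def transport (j : ∀ α : I₀, (Fin (w (.inl α)) → ℂ) →ₗ[ℂ] (Fin (u (.inl α)) → ℂ))
    (q : ∀ β : I₁, (Fin (u (.inr β)) → ℂ) →ₗ[ℂ] (Fin (w (.inr β)) → ℂ))
    (e : RepSpace Ω w w') : RepSpace Ω u w' :=
  (fun α => j α ∘ₗ e.1 α, fun β => e.2.1 β ∘ₗ q β, fun β α h => j α ∘ₗ e.2.2 β α h ∘ₗ q β)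

theorem IsRegularMap.transport [Finite I₀] [Finite I₁] [∀ β α, Finite (Ω β α)]
    {j : X → ∀ α : I₀, (Fin (w (.inl α)) → ℂ) →ₗ[ℂ] (Fin (u (.inl α)) → ℂ)}
    {q : X → ∀ β : I₁, (Fin (u (.inr β)) → ℂ) →ₗ[ℂ] (Fin (w (.inr β)) → ℂ)}
    {e : X → RepSpace Ω w w'} (hj : S.IsRegularMap j) (hq : S.IsRegularMap q)
    (he : S.IsRegularMap e) : S.IsRegularMap fun x => transport (j x) (q x) (e x) :=
  have hj := isRegularMap_pi_iff.1 hj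
  have hq := isRegularMap_pi_iff.1 hq
  have ⟨h₀, h₁, h⟩ := isRegularMap_repSpace_iff.1 he
  isRegularMap_repSpace_iff.2 ⟨fun α => IsRegularMap.hom_comp (hj α) (h₀ α),
    fun β => IsRegularMap.hom_comp (h₁ β) (hq β), fun β α k =>
      IsRegularMap.hom_comp (hj α) (IsRegularMap.hom_comp (h β α k) (hq β))⟩

section Transport

variable {j : ∀ α : I₀, (Fin (w (.inl α)) → ℂ) →ₗ[ℂ] (Fin (u (.inl α)) → ℂ)}
  {q : ∀ β : I₁, (Fin (u (.inr β)) → ℂ) →ₗ[ℂ] (Fin (w (.inr β)) → ℂ)} (e : RepSpace Ω w w')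

theorem transport_transport {t : I₀ ⊕ I₁ → ℕ}
    (j' : ∀ α : I₀, (Fin (u (.inl α)) → ℂ) →ₗ[ℂ] (Fin (t (.inl α)) → ℂ))
    (q' : ∀ β : I₁, (Fin (t (.inr β)) → ℂ) →ₗ[ℂ] (Fin (u (.inr β)) → ℂ)) :
    transport j' q' (transport j q e) = transport (fun α => j' α ∘ₗ j α) (fun β => q β ∘ₗ q' β) e :=
  rfl

theorem sourceMap_transport (β : I₁) : sourceMap (transport j q e) β =
    LinearMap.id.prodMap (LinearMap.piMap fun h => j h.1) ∘ₗ sourceMap e β ∘ₗ q β :=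
  rfl

variable [Fintype I₁] [∀ β α, Fintype (Ω β α)]

theorem sinkMap_transport (α : I₀) : sinkMap (transport j q e) α =
    j α ∘ₗ sinkMap e α ∘ₗ LinearMap.id.prodMap (LinearMap.piMap fun h => q h.1) := by
  refine LinearMap.ext fun a => ?_
  simp only [sinkMap, transport, LinearMap.comp_apply, LinearMap.coprod_apply, LinearMap.sum_apply,
    map_add, map_sum]
  rfl

theorem sinkMap_comp_inl (α : I₀) : sinkMap e α ∘ₗ LinearMap.inl ℂ _ _ = e.1 α :=
  LinearMap.coprod_inl _ _

theorem sinkMap_comp_inr_comp_single (α : I₀) [DecidableEq (Σ β, Ω β α)] (h : Σ β, Ω β α) :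
    sinkMap e α ∘ₗ LinearMap.inr ℂ _ _ ∘ₗ LinearMap.single ℂ _ h = e.2.2 h.1 α h.2 := by
  rw [← LinearMap.comp_assoc, sinkMap, LinearMap.coprod_inr]
  refine LinearMap.ext fun b => ?_
  simp only [LinearMap.comp_apply, LinearMap.sum_apply, LinearMap.proj_apply]
  rw [Finset.sum_eq_single_of_mem h (Finset.mem_univ h)]
  · rw [LinearMap.single_apply, Pi.single_eq_same]
  · intro k _ hk
    rw [LinearMap.single_apply, Pi.single_eq_of_ne hk, map_zero]

theorem vertexRank_transport (hj : ∀ α, Function.Injective (j α))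
    (hq : ∀ β, Function.Surjective (q β)) : vertexRank (transport j q e) = vertexRank e := by
  funext i
  rcases i with α | β <;> simp only [vertexRank]
  · rw [sinkMap_transport]
    refine finrank_range_comp_comp (hj α) _ ?_
    exact Function.surjective_id.prodMap (Function.Surjective.piMap fun h => hq h.1)
  · rw [sourceMap_transport]
    refine finrank_range_comp_comp ?_ _ (hq β)
    exact Function.injective_id.prodMap (Function.Injective.piMap fun h => hj h.1)

theorem transport_mem_stratum_iff (hj : ∀ α, Function.Injective (j α))
    (hq : ∀ β, Function.Surjective (q β)) {t : I₀ ⊕ I₁ → ℕ} :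
    transport j q e ∈ stratum Ω t u w' ↔ e ∈ stratum Ω t w w' := by
  rw [stratum, stratum, Set.mem_ofPred_eq, Set.mem_ofPred_eq, vertexRank_transport e hj hq]

variable {e}

theorem transport_eq_self
    {π : ∀ α : I₀, (Fin (w (.inl α)) → ℂ) →ₗ[ℂ] (Fin (w (.inl α)) → ℂ)}
    {θ : ∀ β : I₁, (Fin (w (.inr β)) → ℂ) →ₗ[ℂ] (Fin (w (.inr β)) → ℂ)}
    (hπ : ∀ α, π α ∘ₗ sinkMap e α = sinkMap e α)
    (hθ : ∀ β, sourceMap e β ∘ₗ θ β = sourceMap e β) : transport π θ e = e := by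
  classical
  have hx (α) : π α ∘ₗ e.1 α = e.1 α := by
    rw [← sinkMap_comp_inl e α, ← LinearMap.comp_assoc, hπ]
  have hy (α) (h : Σ β, Ω β α) : π α ∘ₗ e.2.2 h.1 α h.2 = e.2.2 h.1 α h.2 := by
    rw [← sinkMap_comp_inr_comp_single e α h, ← LinearMap.comp_assoc, hπ]
  have hx' (β) : e.2.1 β ∘ₗ θ β = e.2.1 β := congrArg (LinearMap.fst ℂ _ _ ∘ₗ ·) (hθ β)
  have hy' (β) (h : Σ α, Ω β α) : e.2.2 β h.1 h.2 ∘ₗ θ β = e.2.2 β h.1 h.2 :=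
    congrArg (LinearMap.proj h ∘ₗ LinearMap.snd ℂ _ _ ∘ₗ ·) (hθ β)
  refine Prod.ext (funext hx) (Prod.ext (funext hx') ?_)
  refine funext fun β => funext fun α => funext fun h => ?_
  exact (congrArg (π α ∘ₗ ·) (hy' β ⟨α, h⟩)).trans (hy α ⟨β, h⟩)

end Transport

section Strata

theorem lDominant_iff [Fintype I₀] [Fintype I₁] [∀ β α, Fintype (Ω β α)] :
    LDominant Ω u w w' ↔ ∀ i, u i ≤ w i ∧ u i ≤ w' i + adjacentSum Ω u i :=
  forall_congr' fun i => by omega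

theorem exists_sourceMap_eq (T : ∀ β : I₁, (Fin (w (.inr β)) → ℂ) →ₗ[ℂ]
    (Fin (w' (.inr β)) → ℂ) × (∀ h : (Σ α, Ω β α), Fin (w (.inl h.1)) → ℂ)) :
    ∃ e : RepSpace Ω w w', ∀ β, sourceMap e β = T β :=
  ⟨(0, fun β => LinearMap.fst ℂ _ _ ∘ₗ T β,
    fun β α h => LinearMap.proj (⟨α, h⟩ : Σ α, Ω β α) ∘ₗ LinearMap.snd ℂ _ _ ∘ₗ T β), fun _ => rfl⟩

theorem isOpen_sourceMap_injective [Finite I₀] [Finite I₁] [∀ β α, Finite (Ω β α)]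
    {e : X → RepSpace Ω w w'} (he : S.IsRegularMap e) :
    IsOpen[S.toTopologicalSpace] {x | ∀ β, Function.Injective (sourceMap (e x) β)} := by
  let _ := S.toTopologicalSpace
  rw [Set.ofPred_forall]
  exact isOpen_iInter_of_finite fun β => isOpen_injective (IsRegularMap.sourceMap he β)

variable [Fintype I₁] [∀ β α, Fintype (Ω β α)]

theorem mem_stratum_self_iff {e : RepSpace Ω u w'} : e ∈ stratum Ω u u w' ↔
    (∀ α, Function.Surjective (sinkMap e α)) ∧ ∀ β, Function.Injective (sourceMap e β) := by
  refine Sum.forall.trans (and_congr (forall_congr' fun α => ?_) (forall_congr' fun β => ?_))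
  · rw [vertexRank, ← LinearMap.range_eq_top, Submodule.eq_top_iff_finrank_eq,
      Module.finrank_fin_fun]
  · rw [vertexRank, ← LinearMap.ker_eq_bot, ← Submodule.finrank_eq_zero]
    have := LinearMap.finrank_range_add_finrank_ker (sourceMap e β)
    rw [Module.finrank_fin_fun] at this
    omega

theorem isOpen_sinkMap_surjective [Finite I₀] {e : X → RepSpace Ω w w'} (he : S.IsRegularMap e) :
    IsOpen[S.toTopologicalSpace] {x | ∀ α, Function.Surjective (sinkMap (e x) α)} := by
  let _ := S.toTopologicalSpace
  rw [Set.ofPred_forall]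
  exact isOpen_iInter_of_finite fun α => isOpen_surjective (IsRegularMap.sinkMap he α)

theorem isOpen_stratum_self [Finite I₀] {e : X → RepSpace Ω u w'} (he : S.IsRegularMap e) :
    IsOpen[S.toTopologicalSpace] {x | e x ∈ stratum Ω u u w'} := by
  let _ := S.toTopologicalSpace
  simp only [mem_stratum_self_iff]
  exact (isOpen_sinkMap_surjective he).inter (isOpen_sourceMap_injective he)

theorem exists_split_transport_eq {e : RepSpace Ω w w'} (he : e ∈ stratum Ω u w w') :
    ∃ (j : ∀ α : I₀, (Fin (u (.inl α)) → ℂ) →ₗ[ℂ] (Fin (w (.inl α)) → ℂ))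
      (ρ : ∀ α : I₀, (Fin (w (.inl α)) → ℂ) →ₗ[ℂ] (Fin (u (.inl α)) → ℂ))
      (q : ∀ β : I₁, (Fin (w (.inr β)) → ℂ) →ₗ[ℂ] (Fin (u (.inr β)) → ℂ))
      (σ : ∀ β : I₁, (Fin (u (.inr β)) → ℂ) →ₗ[ℂ] (Fin (w (.inr β)) → ℂ)),
      (∀ α, ρ α ∘ₗ j α = LinearMap.id) ∧ (∀ β, q β ∘ₗ σ β = LinearMap.id) ∧
      transport ρ σ e ∈ stratum Ω u u w' ∧ transport j q (transport ρ σ e) = e := by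
  choose j ρ a _ hρj _ hja using fun α => exists_split_rank_factorization
    (G := Fin (u (.inl α)) → ℂ) ((he (.inl α)).trans (Module.finrank_fin_fun ℂ).symm)
  choose b _ q σ _ hqσ hbq using fun β => exists_split_rank_factorization
    (G := Fin (u (.inr β)) → ℂ) ((he (.inr β)).trans (Module.finrank_fin_fun ℂ).symm)
  have heq : transport j q (transport ρ σ e) = e := by
    rw [transport_transport]
    refine transport_eq_self (fun α => ?_) fun β => ?_
    · rw [← hja, LinearMap.comp_assoc, ← LinearMap.comp_assoc (a α), hρj, LinearMap.id_comp]
    · rw [← hbq, LinearMap.comp_assoc, ← LinearMap.comp_assoc (q β), hqσ, LinearMap.id_comp]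
  refine ⟨j, ρ, q, σ, hρj, hqσ, (transport_mem_stratum_iff _
    (fun α => LinearMap.injective_of_comp_eq_id _ _ (hρj α))
    (fun β => LinearMap.surjective_of_comp_eq_id _ _ (hqσ β))).1 ?_, heq⟩
  rwa [heq]

theorem exists_sinkMap_eq (T : ∀ α : I₀, (Fin (w' (.inl α)) → ℂ) ×
    (∀ h : (Σ β, Ω β α), Fin (w (.inr h.1)) → ℂ) →ₗ[ℂ] (Fin (w (.inl α)) → ℂ)) :
    ∃ e : RepSpace Ω w w', ∀ α, sinkMap e α = T α := by
  classical
  refine ⟨(fun α => T α ∘ₗ LinearMap.inl ℂ _ _, 0, fun β α h => T α ∘ₗ LinearMap.inr ℂ _ _ ∘ₗ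
    LinearMap.single ℂ (fun k : (Σ β, Ω β α) => Fin (w (.inr k.1)) → ℂ) ⟨β, h⟩), fun α => ?_⟩
  refine LinearMap.prod_ext (sinkMap_comp_inl _ α) (LinearMap.pi_ext' fun h => ?_)
  exact sinkMap_comp_inr_comp_single _ α h

variable [Fintype I₀]

theorem finrank_sink (α : I₀) : Module.finrank ℂ
    ((Fin (w' (.inl α)) → ℂ) × (∀ h : (Σ β, Ω β α), Fin (w (.inr h.1)) → ℂ)) =
      w' (.inl α) + adjacentSum Ω w (.inl α) := by
  simp [Module.finrank_pi_fintype, adjacentSum]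

theorem finrank_source (β : I₁) : Module.finrank ℂ
    ((Fin (w' (.inr β)) → ℂ) × (∀ h : (Σ α, Ω β α), Fin (w (.inl h.1)) → ℂ)) =
      w' (.inr β) + adjacentSum Ω w (.inr β) := by
  simp [Module.finrank_pi_fintype, adjacentSum]

theorem stratum_self_nonempty (h : ∀ i, u i ≤ w' i + adjacentSum Ω u i) :
    (stratum Ω u u w').Nonempty := by
  have hid := isRegularMap_id (E := RepSpace Ω u w')
  choose s T hT using fun α : I₀ => exists_comp_eq_id_of_finrank_le (K := ℂ)
    (E := Fin (u (.inl α)) → ℂ)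
    (F := (Fin (w' (.inl α)) → ℂ) × (∀ h : (Σ β, Ω β α), Fin (u (.inr h.1)) → ℂ))
    (by rw [finrank_sink, Module.finrank_fin_fun]; exact h (.inl α))
  choose R r hR using fun β : I₁ => exists_comp_eq_id_of_finrank_le (K := ℂ)
    (E := Fin (u (.inr β)) → ℂ)
    (F := (Fin (w' (.inr β)) → ℂ) × (∀ h : (Σ α, Ω β α), Fin (u (.inl h.1)) → ℂ))
    (by rw [finrank_source, Module.finrank_fin_fun]; exact h (.inr β))
  obtain ⟨e₀, he₀⟩ := exists_sinkMap_eq T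
  obtain ⟨e₁, he₁⟩ := exists_sourceMap_eq R
  obtain ⟨e, he⟩ := affineSpace_inter_nonempty (isOpen_sinkMap_surjective hid)
    (isOpen_sourceMap_injective hid)
    ⟨e₀, fun α => by rw [he₀]; exact LinearMap.surjective_of_comp_eq_id _ _ (hT α)⟩
    ⟨e₁, fun β => by rw [he₁]; exact LinearMap.injective_of_comp_eq_id _ _ (hR β)⟩
  exact ⟨e, mem_stratum_self_iff.2 he⟩

theorem stratum_nonempty_iff : (stratum Ω u w w').Nonempty ↔ LDominant Ω u w w' := by
  rw [lDominant_iff]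
  refine ⟨fun ⟨e, he⟩ => ?_, fun h => ?_⟩
  · obtain ⟨j, ρ, q, σ, hρj, hqσ, he', -⟩ := exists_split_transport_eq he
    obtain ⟨hsurj, hinj⟩ := mem_stratum_self_iff.1 he'
    rintro (α | β)
    · have hj := LinearMap.finrank_le_finrank_of_injective
        (LinearMap.injective_of_comp_eq_id _ _ (hρj α))
      have hsink := LinearMap.finrank_le_finrank_of_surjective (hsurj α)
      rw [finrank_sink] at hsink
      simp only [Module.finrank_fin_fun] at hj hsink
      exact ⟨hj, hsink⟩
    · have hq := LinearMap.finrank_le_finrank_of_surjective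
        (LinearMap.surjective_of_comp_eq_id _ _ (hqσ β))
      have hsource := LinearMap.finrank_le_finrank_of_injective (hinj β)
      rw [finrank_source] at hsource
      simp only [Module.finrank_fin_fun] at hq hsource
      exact ⟨hq, hsource⟩
  · obtain ⟨e, he⟩ := stratum_self_nonempty fun i => (h i).2
    choose j ρ hρj using fun α : I₀ => exists_comp_eq_id_of_finrank_le (K := ℂ)
      (E := Fin (u (.inl α)) → ℂ) (F := Fin (w (.inl α)) → ℂ)
      (by simpa only [Module.finrank_fin_fun] using (h (.inl α)).1)
    choose σ q hqσ using fun β : I₁ => exists_comp_eq_id_of_finrank_le (K := ℂ)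
      (E := Fin (u (.inr β)) → ℂ) (F := Fin (w (.inr β)) → ℂ)
      (by simpa only [Module.finrank_fin_fun] using (h (.inr β)).1)
    exact ⟨transport j q e, (transport_mem_stratum_iff _
      (fun α => LinearMap.injective_of_comp_eq_id _ _ (hρj α))
      (fun β => LinearMap.surjective_of_comp_eq_id _ _ (hqσ β))).2 he⟩

end Strata

section Factorizations

/-- The ambient affine space of the triples `(e, j, q)` for which `transport j q e` is a
representation with the dimensions `(w, w')`. -/
abbrev FactorizationSpace (Ω : I₁ → I₀ → Type*) (u w w' : I₀ ⊕ I₁ → ℕ) : Type _ :=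
  RepSpace Ω u w' × (∀ α : I₀, (Fin (u (.inl α)) → ℂ) →ₗ[ℂ] (Fin (w (.inl α)) → ℂ)) ×
    (∀ β : I₁, (Fin (w (.inr β)) → ℂ) →ₗ[ℂ] (Fin (u (.inr β)) → ℂ))

/-- The representation that is factored by a triple `(e, j, q)`. -/
def FactorizationSpace.composite (p : FactorizationSpace Ω u w w') : RepSpace Ω w w' :=
  transport p.2.1 p.2.2 p.1

theorem isRegularMap_composite [Finite I₀] [Finite I₁] [∀ β α, Finite (Ω β α)] :
    (affineSpace (FactorizationSpace Ω u w w')).IsRegularMap FactorizationSpace.composite :=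
  have ⟨he, hjq⟩ := isRegularMap_prod_iff.1 isRegularMap_id
  have ⟨hj, hq⟩ := isRegularMap_prod_iff.1 hjq
  IsRegularMap.transport hj hq he

variable [Fintype I₁] [∀ β α, Fintype (Ω β α)]

/-- The triples `(e, j, q)` such that `transport j q e` is a simultaneous rank factorization of all
its maps `A_i`: `j` is injective, `q` is surjective, and the maps `A_i` of `e` have full rank. -/
def factorizations (Ω : I₁ → I₀ → Type*) [∀ β α, Fintype (Ω β α)] (u w w' : I₀ ⊕ I₁ → ℕ) :
    Set (FactorizationSpace Ω u w w') :=
  {p | p.1 ∈ stratum Ω u u w' ∧ (∀ α, Function.Injective (p.2.1 α)) ∧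
    ∀ β, Function.Surjective (p.2.2 β)}

theorem isOpen_factorizations [Finite I₀] :
    IsOpen[(affineSpace (FactorizationSpace Ω u w w')).toTopologicalSpace]
      (factorizations Ω u w w') := by
  let _ := (affineSpace (FactorizationSpace Ω u w w')).toTopologicalSpace
  have ⟨he, hjq⟩ := isRegularMap_prod_iff.1 (isRegularMap_id (E := FactorizationSpace Ω u w w'))
  have ⟨hj, hq⟩ := isRegularMap_prod_iff.1 hjq
  simp only [factorizations, Set.ofPred_and, Set.ofPred_forall]
  refine (isOpen_stratum_self he).inter (IsOpen.inter ?_ ?_)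
  · exact isOpen_iInter_of_finite fun α => isOpen_injective (isRegularMap_pi_iff.1 hj α)
  · exact isOpen_iInter_of_finite fun β => isOpen_surjective (isRegularMap_pi_iff.1 hq β)

theorem composite_mem_stratum {p : FactorizationSpace Ω u w w'}
    (hp : p ∈ factorizations Ω u w w') : p.composite ∈ stratum Ω u w w' :=
  (transport_mem_stratum_iff _ hp.2.1 hp.2.2).2 hp.1

theorem exists_composite_eq {e : RepSpace Ω w w'} (he : e ∈ stratum Ω u w w') :
    ∃ p ∈ factorizations Ω u w w', p.composite = e := by
  obtain ⟨j, ρ, q, σ, hρj, hqσ, he', heq⟩ := exists_split_transport_eq he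
  exact ⟨(transport ρ σ e, j, q), ⟨he', fun α => LinearMap.injective_of_comp_eq_id _ _ (hρj α),
    fun β => LinearMap.surjective_of_comp_eq_id _ _ (hqσ β)⟩, heq⟩

theorem isIrred_stratum [Fintype I₀] (h : LDominant Ω u w w') :
    ((repSpace Ω w w').sub (stratum Ω u w w')).IsIrred := by
  let f (p : factorizations Ω u w w') : stratum Ω u w w' :=
    ⟨p.1.composite, composite_mem_stratum p.2⟩
  have hf : IsMorphism ((affineSpace _).sub (factorizations Ω u w w'))
      ((repSpace Ω w w').sub (stratum Ω u w w')) f :=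
    isMorphism_sub_iff.2 (isMorphism_affineSpace_iff.2
      (isRegularMap_composite.restrict (factorizations Ω u w w')))
  have hsurj : Function.Surjective f := fun ⟨e, he⟩ =>
    have ⟨p, hp, hpe⟩ := exists_composite_eq he
    ⟨⟨p, hp⟩, Subtype.ext hpe⟩
  obtain ⟨e, he⟩ := stratum_nonempty_iff.2 h
  obtain ⟨p, hp, -⟩ := exists_composite_eq he
  exact isIrred_of_surjective isOpen_factorizations ⟨p, hp⟩ hf hsurj

end Factorizations

end Representations

/-! ### Charts of the strata -/

namespace SpaceWithFunctions

variable {X Y Z : Type*} {S : SpaceWithFunctions X} {T : SpaceWithFunctions Y}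
  {R : SpaceWithFunctions Z}

theorem _root_.IsIsomorphism.trans {e : X ≃ Y} {e' : Y ≃ Z} (he : IsIsomorphism S T e)
    (he' : IsIsomorphism T R e') : IsIsomorphism S R (e.trans e') :=
  ⟨he'.1.comp he.1, he.2.comp he'.2⟩

/-- `S` has a chart at `x`: an open neighbourhood that is isomorphic to an open subset of an affine
space. -/
def HasChartAt (S : SpaceWithFunctions X) (x : X) : Prop :=
  ∃ (m : ℕ) (U : Set X) (V : Set (Fin m → ℂ)), IsOpen[S.toTopologicalSpace] U ∧ x ∈ U ∧
    IsOpen[(affineSpace (Fin m → ℂ)).toTopologicalSpace] V ∧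
    ∃ e : U ≃ V, IsIsomorphism (S.sub U) ((affineSpace (Fin m → ℂ)).sub V) e

theorem isNonsingular_of_hasChartAt (h : ∀ x, S.HasChartAt x) : S.IsNonsingular := by
  refine isNonsingular_of_local fun x => ?_
  obtain ⟨m, U, V, hU, hx, hV, e, he⟩ := h x
  exact ⟨U, hU, hx, (isOpenImmersion_of_isIsomorphism he).isNonsingular
    ((isOpenImmersion_val hV).isNonsingular isNonsingular_affineSpace)⟩

theorem IsIrred.isRational (hS : S.IsIrred) (h : ∀ x, S.HasChartAt x) : S.IsRational := by
  refine ⟨hS, ?_⟩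
  let _ := S.toTopologicalSpace
  obtain ⟨x⟩ := hS.toNonempty
  obtain ⟨m, U, V, hU, hx, hV, e, he⟩ := h x
  exact ⟨m, U, V, hU, ⟨x, hx⟩, hV, ⟨_, (e ⟨x, hx⟩).2⟩, e, he⟩

theorem exists_isIsomorphism_slice {P F : Type*} [AddCommGroup P] [Module ℂ P]
    [FiniteDimensional ℂ P] [AddCommGroup F] [Module ℂ F] (L : P →ₗ[ℂ] F) {c : F} {x₀ : P}
    (hx₀ : L x₀ = c) {O : Set P} (hO : IsOpen[(affineSpace P).toTopologicalSpace] O) :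
    ∃ (m : ℕ) (V : Set (Fin m → ℂ)), IsOpen[(affineSpace (Fin m → ℂ)).toTopologicalSpace] V ∧
      ∃ e : {p | p ∈ O ∧ L p = c} ≃ V,
        IsIsomorphism ((affineSpace P).sub _) ((affineSpace (Fin m → ℂ)).sub V) e := by
  let φ : (Fin (Module.finrank ℂ (LinearMap.ker L)) → ℂ) ≃ₗ[ℂ] LinearMap.ker L :=
    LinearEquiv.ofFinrankEq _ _ (Module.finrank_fin_fun ℂ)
  let i : (Fin (Module.finrank ℂ (LinearMap.ker L)) → ℂ) →ₗ[ℂ] P :=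
    (LinearMap.ker L).subtype ∘ₗ φ.toLinearMap
  obtain ⟨r, hri⟩ := i.exists_leftInverse_of_injective
    (LinearMap.ker_eq_bot.2 ((Submodule.subtype_injective _).comp φ.injective))
  have hLi z : L (x₀ + i z) = c := by
    rw [map_add, hx₀, show L (i z) = 0 from (φ z).2, add_zero]
  have hir {p : P} (hp : L p = c) : x₀ + i (r (p - x₀)) = p := by
    obtain ⟨z, hz⟩ := φ.surjective ⟨p - x₀, by rw [LinearMap.mem_ker, map_sub, hp, hx₀, sub_self]⟩
    have hiz : i z = p - x₀ := congrArg Subtype.val hz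
    rw [← hiz, show r (i z) = z from LinearMap.congr_fun hri z, hiz, add_sub_cancel]
  have hg : (affineSpace _).IsRegularMap fun z => x₀ + i z :=
    IsRegularMap.add (isRegularMap_const x₀) (isRegularMap_id.linearMap_comp i)
  have hs : (affineSpace P).IsRegularMap fun p => r (p - x₀) :=
    (IsRegularMap.sub isRegularMap_id (isRegularMap_const x₀)).linearMap_comp r
  refine ⟨_, {z | x₀ + i z ∈ O}, (isMorphism_affineSpace_iff.2 hg).isOpen_preimage hO,
    { toFun p := ⟨r (p - x₀), by rw [Set.mem_ofPred_eq, hir p.2.2]; exact p.2.1⟩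
      invFun z := ⟨x₀ + i z, z.2, hLi z⟩
      left_inv p := Subtype.ext (hir p.2.2)
      right_inv z := Subtype.ext ((congrArg r (add_sub_cancel_left x₀ (i z))).trans
        (LinearMap.congr_fun hri z)) }, ?_, ?_⟩
  · exact isMorphism_sub_iff.2 (isMorphism_affineSpace_iff.2 (hs.restrict _))
  · exact isMorphism_sub_iff.2 (isMorphism_affineSpace_iff.2 (hg.restrict _))

end SpaceWithFunctions

section StratumCharts

open SpaceWithFunctions

variable {I₀ I₁ : Type*} {Ω : I₁ → I₀ → Type*} [Fintype I₁] [∀ β α, Fintype (Ω β α)]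
  {u w w' : I₀ ⊕ I₁ → ℕ}
  (ρ : ∀ α : I₀, (Fin (w (.inl α)) → ℂ) →ₗ[ℂ] (Fin (u (.inl α)) → ℂ))
  (σ : ∀ β : I₁, (Fin (u (.inr β)) → ℂ) →ₗ[ℂ] (Fin (w (.inr β)) → ℂ))

/-- The rank factorizations `(e, j, q)` normalized by `ρ ∘ j = id` and `q ∘ σ = id`. They form an
open subset of an affine subspace, which meets every orbit of the group `∏ GL(u_i)` acting on the
rank factorizations at most once. -/
def normalizedFactorizations : Set (FactorizationSpace Ω u w w') :=
  {p | p.1 ∈ stratum Ω u u w' ∧ (∀ α, ρ α ∘ₗ p.2.1 α = LinearMap.id) ∧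
    ∀ β, p.2.2 β ∘ₗ σ β = LinearMap.id}

/-- The representations in the stratum that have a factorization normalized by `ρ` and `σ`. -/
def chartDomain : Set (stratum Ω u w w') :=
  {e | transport ρ σ e.1 ∈ stratum Ω u u w'}

variable {ρ σ}

theorem normalizedFactorizations_subset :
    normalizedFactorizations ρ σ ⊆ factorizations Ω u w w' := fun _ hp =>
  ⟨hp.1, fun α => LinearMap.injective_of_comp_eq_id _ _ (hp.2.1 α),
    fun β => LinearMap.surjective_of_comp_eq_id _ _ (hp.2.2 β)⟩

section Normalized

variable {p : FactorizationSpace Ω u w w'} (hp : p ∈ normalizedFactorizations ρ σ)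

include hp

theorem transport_composite : transport ρ σ p.composite = p.1 := by
  rw [FactorizationSpace.composite, transport_transport]
  simp only [hp.2.1, hp.2.2]
  rfl

theorem comp_sinkMap_composite (α : I₀) :
    p.2.1 α ∘ₗ ρ α ∘ₗ sinkMap p.composite α = sinkMap p.composite α := by
  rw [FactorizationSpace.composite, sinkMap_transport, ← LinearMap.comp_assoc _ (p.2.1 α), hp.2.1,
    LinearMap.id_comp]

theorem sourceMap_composite_comp (β : I₁) :
    (sourceMap p.composite β ∘ₗ σ β) ∘ₗ p.2.2 β = sourceMap p.composite β := by
  rw [FactorizationSpace.composite, sourceMap_transport]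
  simp only [LinearMap.comp_assoc]
  rw [← LinearMap.comp_assoc (p.2.2 β) (σ β), hp.2.2, LinearMap.id_comp]

end Normalized

theorem surjective_comp_sinkMap {e : RepSpace Ω w w'} (he : transport ρ σ e ∈ stratum Ω u u w')
    (α : I₀) : Function.Surjective (ρ α ∘ₗ sinkMap e α) := by
  have := (mem_stratum_self_iff.1 he).1 α
  rw [sinkMap_transport, ← LinearMap.comp_assoc, LinearMap.coe_comp] at this
  exact .of_comp this

theorem injective_sourceMap_comp {e : RepSpace Ω w w'} (he : transport ρ σ e ∈ stratum Ω u u w')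
    (β : I₁) : Function.Injective (sourceMap e β ∘ₗ σ β) := by
  have := (mem_stratum_self_iff.1 he).2 β
  rw [sourceMap_transport, LinearMap.coe_comp] at this
  exact .of_comp this

theorem exists_normalizedFactorization {e : stratum Ω u w w'} (he : e ∈ chartDomain ρ σ) :
    ∃ p ∈ normalizedFactorizations ρ σ, p.composite = e.1 := by
  obtain ⟨p, -, hpe⟩ := exists_composite_eq e.2
  have he : transport (fun α => ρ α ∘ₗ p.2.1 α) (fun β => p.2.2 β ∘ₗ σ β) p.1 ∈
      stratum Ω u u w' := by
    rw [← transport_transport, ← FactorizationSpace.composite, hpe]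
    exact he
  have ⟨hsurj, hinj⟩ := mem_stratum_self_iff.1 he
  have hunit₀ (α) : IsUnit (ρ α ∘ₗ p.2.1 α : Module.End ℂ (Fin (u (.inl α)) → ℂ)) := by
    have := hsurj α
    rw [sinkMap_transport, LinearMap.coe_comp] at this
    exact (LinearMap.isUnit_iff_range_eq_top _).2 (LinearMap.range_eq_top.2 (.of_comp this))
  have hunit₁ (β) : IsUnit (p.2.2 β ∘ₗ σ β : Module.End ℂ (Fin (u (.inr β)) → ℂ)) := by
    have := hinj β
    rw [sourceMap_transport, ← LinearMap.comp_assoc, LinearMap.coe_comp] at this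
    exact (LinearMap.isUnit_iff_ker_eq_bot _).2 (LinearMap.ker_eq_bot.2 (.of_comp this))
  refine ⟨(transport (fun α => ρ α ∘ₗ p.2.1 α) (fun β => p.2.2 β ∘ₗ σ β) p.1,
    fun α => p.2.1 α ∘ₗ Ring.inverse (ρ α ∘ₗ p.2.1 α),
    fun β => Ring.inverse (p.2.2 β ∘ₗ σ β) ∘ₗ p.2.2 β), ⟨he, fun α => ?_, fun β => ?_⟩, ?_⟩
  · exact Ring.mul_inverse_cancel _ (hunit₀ α)
  · exact Ring.inverse_mul_cancel _ (hunit₁ β)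
  · rw [← hpe, FactorizationSpace.composite, FactorizationSpace.composite, transport_transport]
    congr 1
    · exact funext fun α => congrArg (p.2.1 α ∘ₗ ·) (Ring.inverse_mul_cancel _ (hunit₀ α))
    · exact funext fun β => congrArg (· ∘ₗ p.2.2 β) (Ring.mul_inverse_cancel _ (hunit₁ β))

variable (ρ σ)

theorem bijective_composite : Function.Bijective
    fun p : normalizedFactorizations (Ω := Ω) (w' := w') ρ σ =>
      (⟨⟨p.1.composite, composite_mem_stratum (normalizedFactorizations_subset p.2)⟩, by
        rw [chartDomain, Set.mem_ofPred_eq, transport_composite p.2]; exact p.2.1⟩ :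
        chartDomain ρ σ) := by
  refine ⟨fun ⟨p, hp⟩ ⟨p', hp'⟩ h => Subtype.ext ?_, fun ⟨e, he⟩ => ?_⟩
  · replace h : p.composite = p'.composite := congrArg (·.1.1) h
    have hmem : transport ρ σ p'.composite ∈ stratum Ω u u w' := by
      rw [transport_composite hp']; exact hp'.1
    refine Prod.ext ?_ (Prod.ext (funext fun α => ?_) (funext fun β => ?_))
    · rw [← transport_composite hp, ← transport_composite hp', h]
    · rw [← LinearMap.cancel_right (surjective_comp_sinkMap hmem α), comp_sinkMap_composite hp',
        ← h, comp_sinkMap_composite hp]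
    · rw [← LinearMap.cancel_left (injective_sourceMap_comp hmem β), sourceMap_composite_comp hp',
        ← h, sourceMap_composite_comp hp]
  · obtain ⟨p, hp, hpe⟩ := exists_normalizedFactorization he
    exact ⟨⟨p, hp⟩, Subtype.ext (Subtype.ext hpe)⟩

/-- The chart of the stratum that sends a representation to its normalized factorization. -/
noncomputable def factorizationChart :
    chartDomain (Ω := Ω) (w' := w') ρ σ ≃ normalizedFactorizations (Ω := Ω) (w' := w') ρ σ :=
  (Equiv.ofBijective _ (bijective_composite ρ σ)).symm

theorem composite_factorizationChart (e : chartDomain (Ω := Ω) (w' := w') ρ σ) :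
    (factorizationChart ρ σ e).1.composite = e.1.1 :=
  congrArg (·.1.1) (Equiv.ofBijective_apply_symm_apply _ (bijective_composite ρ σ) e)

theorem isIsomorphism_factorizationChart [Finite I₀] : IsIsomorphism
    (((repSpace Ω w w').sub (stratum Ω u w w')).sub (chartDomain ρ σ))
    ((affineSpace (FactorizationSpace Ω u w w')).sub (normalizedFactorizations ρ σ))
    (factorizationChart ρ σ) := by
  have he : (((repSpace Ω w w').sub (stratum Ω u w w')).sub (chartDomain ρ σ)).IsRegularMap
      fun x => x.1.1 :=
    (IsRegularMap.restrict isRegularMap_id (stratum Ω u w w')).restrict (chartDomain ρ σ)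
  refine ⟨isMorphism_sub_iff.2 (isMorphism_affineSpace_iff.2 (isRegularMap_prod_iff.2 ⟨?_,
    isRegularMap_prod_iff.2 ⟨isRegularMap_pi_iff.2 fun α => ?_,
      isRegularMap_pi_iff.2 fun β => ?_⟩⟩)), ?_⟩
  · convert IsRegularMap.transport (isRegularMap_const ρ) (isRegularMap_const σ) he using 2 with x
    rw [← composite_factorizationChart, transport_composite (factorizationChart ρ σ x).2]
  · refine IsRegularMap.of_comp_surjective
      (IsRegularMap.hom_comp (isRegularMap_const (ρ α)) (IsRegularMap.sinkMap he α))
      (fun x => surjective_comp_sinkMap x.2 α) ?_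
    convert IsRegularMap.sinkMap he α using 2 with x
    simpa only [composite_factorizationChart] using
      comp_sinkMap_composite (factorizationChart ρ σ x).2 α
  · refine IsRegularMap.of_injective_comp
      (IsRegularMap.hom_comp (IsRegularMap.sourceMap he β) (isRegularMap_const (σ β)))
      (fun x => injective_sourceMap_comp x.2 β) ?_
    convert IsRegularMap.sourceMap he β using 2 with x
    simpa only [composite_factorizationChart] using
      sourceMap_composite_comp (factorizationChart ρ σ x).2 β
  · exact isMorphism_sub_iff.2 (isMorphism_sub_iff.2 (isMorphism_affineSpace_iff.2
      (isRegularMap_composite.restrict (normalizedFactorizations ρ σ))))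

theorem hasChartAt_stratum [Finite I₀] (e : stratum Ω u w w') :
    ((repSpace Ω w w').sub (stratum Ω u w w')).HasChartAt e := by
  obtain ⟨-, ρ, -, σ, -, -, he, -⟩ := exists_split_transport_eq e.2
  have hU : IsOpen[((repSpace Ω w w').sub (stratum Ω u w w')).toTopologicalSpace]
      (chartDomain ρ σ) := isOpen_stratum_self
    ((IsRegularMap.transport (isRegularMap_const ρ) (isRegularMap_const σ)
      isRegularMap_id).restrict (stratum Ω u w w'))
  have hO := isOpen_stratum_self
    (isRegularMap_prod_iff.1 (isRegularMap_id (E := FactorizationSpace Ω u w w'))).1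
  let L := ((LinearMap.piMap fun α =>
      LinearMap.compRight ℂ (M := Fin (u (.inl α)) → ℂ) (ρ α)).prodMap
    (LinearMap.piMap fun β => LinearMap.lcomp ℂ (Fin (u (.inr β)) → ℂ) (σ β))) ∘ₗ
      LinearMap.snd ℂ (RepSpace Ω u w') _
  have hslice : normalizedFactorizations ρ σ = {p : FactorizationSpace Ω u w w' |
      p ∈ {p | p.1 ∈ stratum Ω u u w'} ∧ L p = (fun _ => LinearMap.id, fun _ => LinearMap.id)} := by
    ext p
    refine and_congr_right fun _ => ?_
    simp only [Prod.ext_iff, funext_iff]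
    rfl
  obtain ⟨p, hp, -⟩ := exists_normalizedFactorization (ρ := ρ) (σ := σ) he
  rw [hslice] at hp
  have hchart := exists_isIsomorphism_slice L hp.2 hO
  rw [← hslice] at hchart
  obtain ⟨m, V, hV, f, hf⟩ := hchart
  exact ⟨m, chartDomain ρ σ, V, hU, he, hV, (factorizationChart ρ σ).trans f,
    (isIsomorphism_factorizationChart ρ σ).trans hf⟩

variable (Ω u w w')

theorem isNonsingular_stratum [Finite I₀] :
    ((repSpace Ω w w').sub (stratum Ω u w w')).IsNonsingular :=
  isNonsingular_of_hasChartAt hasChartAt_stratum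

variable {Ω u w w'}

theorem isRational_stratum [Fintype I₀] (h : LDominant Ω u w w') :
    ((repSpace Ω w w').sub (stratum Ω u w w')).IsRational :=
  (isIrred_stratum h).isRational hasChartAt_stratum

end StratumCharts

section Stratification

open SpaceWithFunctions

variable {X I₀ I₁ : Type*} {S : SpaceWithFunctions X} [Fintype I₁] {Ω : I₁ → I₀ → Type*}
  [∀ β α, Fintype (Ω β α)] {u v w w' : I₀ ⊕ I₁ → ℕ}

section Rank

variable [Finite I₀] {e : X → RepSpace Ω w w'}

theorem isClosed_vertexRank_le (he : S.IsRegularMap e) (u : I₀ ⊕ I₁ → ℕ) :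
    @IsClosed _ S.toTopologicalSpace {x | ∀ i, vertexRank (e x) i ≤ u i} := by
  let _ := S.toTopologicalSpace
  classical
  simp only [Set.ofPred_forall]
  refine isClosed_iInter fun i => ⟨?_⟩
  convert isOpen_le_vertexRank he (Pi.single i (u i + 1)) using 1
  ext x
  simp only [Set.mem_compl_iff, Set.mem_ofPred_eq, not_le]
  refine ⟨fun h k => ?_, fun h => by simpa using h i⟩
  obtain rfl | hk := eq_or_ne k i
  · simpa using h
  · simp [hk]

theorem isLocallyClosed_vertexRank_eq (he : S.IsRegularMap e) (u : I₀ ⊕ I₁ → ℕ) :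
    @IsLocallyClosed _ S.toTopologicalSpace {x | ∀ i, vertexRank (e x) i = u i} := by
  let _ := S.toTopologicalSpace
  refine ⟨_, _, isOpen_le_vertexRank he u, isClosed_vertexRank_le he u, ?_⟩
  ext x
  simp only [Set.mem_ofPred_eq, Set.mem_inter_iff, le_antisymm_iff, forall_and, and_comm]

end Rank

theorem stratum_subset_affineQuiverVariety (huv : u ≤ v) :
    stratum Ω u w w' ⊆ affineQuiverVariety Ω v w w' :=
  fun _ he i => (he i).trans_le (huv i)

theorem isNonsingular_stratumIn [Finite I₀] (huv : u ≤ v) :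
    ((affineQuiverSpace Ω v w w').sub (stratumIn Ω u v w w')).IsNonsingular := by
  let f : stratumIn Ω u v w w' ≃ stratum Ω u w w' :=
    { toFun := fun e => ⟨e.1.1, e.2⟩
      invFun := fun e => ⟨⟨e.1, stratum_subset_affineQuiverVariety huv e.2⟩, e.2⟩ }
  have hf : IsIsomorphism ((affineQuiverSpace Ω v w w').sub (stratumIn Ω u v w w'))
      ((repSpace Ω w w').sub (stratum Ω u w w')) f :=
    ⟨isMorphism_sub_iff.2 ((isMorphism_val (affineQuiverVariety Ω v w w')).comp
      (isMorphism_val (S := affineQuiverSpace Ω v w w') _)),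
      isMorphism_sub_iff.2 (isMorphism_sub_iff.2 (isMorphism_val _))⟩
  exact (isOpenImmersion_of_isIsomorphism hf).isNonsingular (isNonsingular_stratum Ω u w w')

variable [Fintype I₀]

theorem lDominant_vertexRank (e : RepSpace Ω w w') : LDominant Ω (vertexRank e) w w' :=
  stratum_nonempty_iff.1 ⟨e, fun _ => rfl⟩

theorem affineQuiverVariety_eq_biUnion_stratum : affineQuiverVariety Ω v w w' =
    ⋃ u ∈ {u : I₀ ⊕ I₁ → ℕ | u ≤ v ∧ LDominant Ω u w w'}, stratum Ω u w w' := by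
  refine Set.Subset.antisymm (fun e he => ?_)
    (Set.iUnion₂_subset fun u hu => stratum_subset_affineQuiverVariety hu.1)
  exact Set.mem_iUnion₂.2 ⟨vertexRank e, ⟨he, lDominant_vertexRank e⟩, fun _ => rfl⟩

theorem isStratification_stratumIn : (affineQuiverSpace Ω v w w').IsStratification
    (fun u : {u : I₀ ⊕ I₁ → ℕ // u ≤ v ∧ LDominant Ω u w w'} => stratumIn Ω u.1 v w w') where
  finite := by
    classical
    exact ((Set.finite_Iic v).subset fun u hu => hu.1).to_subtype
  nonempty u := by
    obtain ⟨e, he⟩ := stratum_nonempty_iff.2 u.2.2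
    exact ⟨⟨e, stratum_subset_affineQuiverVariety u.2.1 he⟩, he⟩
  disjoint u u' hne := Set.disjoint_left.2 fun e he he' =>
    hne (Subtype.ext (funext fun i => (he i).symm.trans (he' i)))
  iUnion_eq := Set.eq_univ_of_forall fun e => Set.mem_iUnion.2
    ⟨⟨vertexRank e.1, e.2, lDominant_vertexRank e.1⟩, fun _ => rfl⟩
  isLocallyClosed u := isLocallyClosed_vertexRank_eq (isRegularMap_id.restrict _) u.1
  isNonsingular u := isNonsingular_stratumIn u.2.1
  closure_subset u := by
    have hclosed := isClosed_vertexRank_le (S := affineQuiverSpace Ω v w w')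
      (isRegularMap_id.restrict _) u.1
    refine (@closure_minimal _ (affineQuiverSpace Ω v w w').toTopologicalSpace
      (stratumIn Ω u.1 v w w') _ (fun e he i => (he i).le) hclosed).trans fun e he => ?_
    exact Set.mem_iUnion₂.2 ⟨⟨vertexRank e.1, e.2, lDominant_vertexRank e.1⟩, he, fun _ => rfl⟩

end Stratification

/-! ### Towers of Grassmannians -/

section SubspacesOfRange

theorem comap_eq_map_of_le_range {K E F : Type*} [Ring K] [AddCommGroup E] [Module K E]
    [AddCommGroup F] [Module K F] {j : E →ₗ[K] F} {ρ : F →ₗ[K] E} (hρj : ρ ∘ₗ j = LinearMap.id)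
    {V : Submodule K F} (hV : V ≤ LinearMap.range j) : V.comap j = V.map ρ := by
  conv_rhs => rw [← Submodule.map_comap_eq_of_le hV, ← Submodule.map_comp, hρj, Submodule.map_id]

variable {E F : Type*} [AddCommGroup E] [Module ℂ E] [AddCommGroup F] [Module ℂ F]

/-- The subspaces of the range of an injective linear map `j`, as subspaces of its domain. -/
def grRangeEquiv {j : E →ₗ[ℂ] F} (hj : Function.Injective j) (d : ℕ) :
    {X : Gr d F // X.1 ≤ LinearMap.range j} ≃ Gr d E where
  toFun X := ⟨X.1.1.comap j, by
    rw [(Submodule.equivMapOfInjective j hj _).finrank_eq, Submodule.map_comap_eq_of_le X.2]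
    exact X.1.2⟩
  invFun Y := ⟨⟨Y.1.map j, (Submodule.equivMapOfInjective j hj _).finrank_eq.symm.trans Y.2⟩,
    LinearMap.map_le_range⟩
  left_inv X := Subtype.ext (Subtype.ext (Submodule.map_comap_eq_of_le X.2))
  right_inv Y := Subtype.ext (Submodule.comap_map_eq_of_injective hj Y.1)

end SubspacesOfRange

section Tower

open SpaceWithFunctions

variable {I₀ I₁ : Type*} {Ω : I₁ → I₀ → Type*} {d : I₀ ⊕ I₁ → ℕ} {a : I₀ → ℕ} {b N : I₁ → ℕ}
  (ρ : ∀ α : I₀, (Fin (a α) → ℂ) →ₗ[ℂ] (Fin (d (.inl α)) → ℂ))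
  (ε : ∀ β : I₁, (Fin (N β) → ℂ) ≃ₗ[ℂ]
    (Fin (b β) → ℂ) × (∀ h : (Σ α, Ω β α), Fin (d (.inl h.1)) → ℂ))

/-- The product of the big cells belonging to the maps `ρ α`. -/
def towerCell : Set (∀ α : I₀, Gr (d (.inl α)) (Fin (a α) → ℂ)) :=
  {X | ∀ α, X α ∈ bigCell (ρ α)}

/-- The isomorphism of `ℂᴺ` with `ℂᵇ ⊕ ⨁ X_{t(h)}` that is induced by the isomorphisms
`X_α ≃ ℂᵈ` on the big cells, as a map to `ℂᵇ ⊕ ⨁ ℂᵃ`. -/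
noncomputable def towerSection (X : towerCell ρ) (β : I₁) : (Fin (N β) → ℂ) →ₗ[ℂ]
    (Fin (b β) → ℂ) × (∀ h : (Σ α, Ω β α), Fin (a h.1) → ℂ) :=
  LinearMap.id.prodMap (LinearMap.piMap fun h : (Σ α, Ω β α) =>
    cellSection (ρ h.1) ⟨X.1 h.1, X.2 h.1⟩) ∘ₗ (ε β).toLinearMap

/-- A left inverse of `towerSection` that does not depend on the point of the cell. -/
def towerRetraction (β : I₁) : (Fin (b β) → ℂ) × (∀ h : (Σ α, Ω β α), Fin (a h.1) → ℂ) →ₗ[ℂ]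
    (Fin (N β) → ℂ) :=
  (ε β).symm.toLinearMap ∘ₗ LinearMap.id.prodMap (LinearMap.piMap fun h => ρ h.1)

theorem towerRetraction_comp_towerSection (X : towerCell ρ) (β : I₁) :
    towerRetraction ρ ε β ∘ₗ towerSection ρ ε X β = LinearMap.id := by
  refine LinearMap.ext fun c => (ε β).symm_apply_eq.2 (Prod.ext rfl (funext fun h => ?_))
  exact LinearMap.congr_fun (comp_cellSection (ρ := ρ h.1) ⟨X.1 h.1, X.2 h.1⟩) _

theorem injective_towerSection (X : towerCell ρ) (β : I₁) :
    Function.Injective (towerSection ρ ε X β) :=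
  LinearMap.injective_of_comp_eq_id _ _ (towerRetraction_comp_towerSection ρ ε X β)

theorem range_towerSection (X : towerCell ρ) (β : I₁) :
    LinearMap.range (towerSection ρ ε X β) = Submodule.prod ⊤
      (Submodule.pi Set.univ fun h : (Σ α, Ω β α) => (X.1 h.1).1) := by
  rw [towerSection, LinearMap.range_comp, LinearEquiv.range, Submodule.map_top,
    LinearMap.range_prodMap, LinearMap.range_id]
  congr 1
  refine SetLike.coe_injective ((Set.range_piMap fun h : (Σ α, Ω β α) =>
    ⇑(cellSection (ρ h.1) ⟨X.1 h.1, X.2 h.1⟩)).trans ?_)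
  exact congrArg (Set.pi _) (funext fun h =>
    congrArg SetLike.coe (range_cellSection (ρ := ρ h.1) ⟨X.1 h.1, X.2 h.1⟩))

theorem le_range_towerSection (X : towerProj Ω d a b ⁻¹' towerCell ρ) (β : I₁) :
    (X.1.1.2 β).1 ≤ LinearMap.range (towerSection ρ ε ⟨towerProj Ω d a b X.1, X.2⟩ β) :=
  (X.1.2 β).trans (range_towerSection ρ ε ⟨towerProj Ω d a b X.1, X.2⟩ β).ge

/-- The trivialization of `towerProj` over a product of big cells. -/
noncomputable def towerTrivialization : towerProj Ω d a b ⁻¹' towerCell ρ ≃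
    towerCell ρ × (∀ β, Gr (d (.inr β)) (Fin (N β) → ℂ)) where
  toFun X := (⟨towerProj Ω d a b X.1, X.2⟩, fun β =>
    grRangeEquiv (injective_towerSection ρ ε _ β) _ ⟨X.1.1.2 β, le_range_towerSection ρ ε X β⟩)
  invFun q := ⟨⟨(q.1.1, fun β =>
    ((grRangeEquiv (injective_towerSection ρ ε q.1 β) _).symm (q.2 β)).1), fun β =>
      ((grRangeEquiv (injective_towerSection ρ ε q.1 β) _).symm (q.2 β)).2.trans
        (range_towerSection ρ ε q.1 β).le⟩, q.1.2⟩
  left_inv X := Subtype.ext (Subtype.ext (Prod.ext rfl (funext fun β => congrArg Subtype.val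
    ((grRangeEquiv (injective_towerSection ρ ε _ β) _).symm_apply_apply
      ⟨X.1.1.2 β, le_range_towerSection ρ ε X β⟩))))
  right_inv q := Prod.ext rfl (funext fun β =>
    (grRangeEquiv (injective_towerSection ρ ε q.1 β) _).apply_symm_apply (q.2 β))

theorem isOpen_towerCell [Finite I₀] : IsOpen[(SpaceWithFunctions.pi fun α : I₀ =>
    grassmannian (d (.inl α)) (Fin (a α) → ℂ)).toTopologicalSpace] (towerCell ρ) := by
  let _ := (SpaceWithFunctions.pi fun α : I₀ =>
    grassmannian (d (.inl α)) (Fin (a α) → ℂ)).toTopologicalSpace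
  rw [towerCell, Set.ofPred_forall]
  exact isOpen_iInter_of_finite fun α => (isMorphism_apply α).isOpen_preimage (isOpen_bigCell (ρ α))

variable [Finite I₀] [∀ β α, Finite (Ω β α)]

theorem isRegularMap_towerSection (β : I₁) : ((SpaceWithFunctions.pi fun α : I₀ =>
    grassmannian (d (.inl α)) (Fin (a α) → ℂ)).sub (towerCell ρ)).IsRegularMap
      fun X => towerSection ρ ε X β := by
  refine IsRegularMap.hom_comp (IsRegularMap.hom_prod (isRegularMap_const _)
    ((IsRegularMap.hom_pi fun h : (Σ α, Ω β α) => ?_).hom_comp (isRegularMap_const _)))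
    (isRegularMap_const _)
  refine ((isRegularMap_cellSection (ρ h.1)).comp ?_).hom_comp (isRegularMap_const _)
  exact isMorphism_sub_iff.2 ((isMorphism_apply h.1).comp (isMorphism_val (towerCell ρ)))

theorem isIsomorphism_towerTrivialization : IsIsomorphism
    (((grProductSpace Ω d a b).sub (towerVariety Ω d a b)).sub
      (towerProj Ω d a b ⁻¹' towerCell ρ))
    (((SpaceWithFunctions.pi fun α : I₀ => grassmannian (d (.inl α)) (Fin (a α) → ℂ)).sub
      (towerCell ρ)).prod
        (SpaceWithFunctions.pi fun β : I₁ => grassmannian (d (.inr β)) (Fin (N β) → ℂ)))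
    (towerTrivialization ρ ε) := by
  constructor
  · have ⟨hsink, hsource⟩ := isMorphism_prod_iff.1
      ((isMorphism_val (S := grProductSpace Ω d a b) (towerVariety Ω d a b)).comp
        (isMorphism_val (towerProj Ω d a b ⁻¹' towerCell ρ)))
    refine isMorphism_prod_iff.2 ⟨isMorphism_sub_iff.2 hsink, isMorphism_pi_iff.2 fun β => ?_⟩
    exact isMorphism_grassmannian_map (isMorphism_pi_iff.1 hsource β)
      (isRegularMap_const (towerRetraction ρ ε β)) fun X => comap_eq_map_of_le_range
        (towerRetraction_comp_towerSection ρ ε _ β) (le_range_towerSection ρ ε X β)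
  · refine isMorphism_sub_iff.2 (isMorphism_sub_iff.2 (isMorphism_prod_iff.2
      ⟨(isMorphism_val (towerCell ρ)).comp isMorphism_fst, isMorphism_pi_iff.2 fun β => ?_⟩))
    exact isMorphism_grassmannian_map ((isMorphism_apply β).comp isMorphism_snd)
      ((isRegularMap_towerSection ρ ε β).comp isMorphism_fst) fun _ => rfl

end Tower

theorem isLocallyTrivialBundle_towerProj {I₀ I₁ : Type*} [Fintype I₀] {Ω : I₁ → I₀ → Type*}
    [∀ β α, Fintype (Ω β α)] (d : I₀ ⊕ I₁ → ℕ) (a : I₀ → ℕ) {b N : I₁ → ℕ}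
    (hN : ∀ β, N β = b β + ∑ h : (Σ α, Ω β α), d (.inl h.1)) :
    SpaceWithFunctions.IsLocallyTrivialBundle
      ((grProductSpace Ω d a b).sub (towerVariety Ω d a b))
      (SpaceWithFunctions.pi fun α : I₀ => grassmannian (d (.inl α)) (Fin (a α) → ℂ))
      (SpaceWithFunctions.pi fun β : I₁ => grassmannian (d (.inr β)) (Fin (N β) → ℂ))
      (towerProj Ω d a b) := by
  intro X
  choose ρ hρ using fun α => exists_mem_bigCell (X α)
  let ε (β : I₁) : (Fin (N β) → ℂ) ≃ₗ[ℂ]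
      (Fin (b β) → ℂ) × (∀ h : (Σ α, Ω β α), Fin (d (.inl h.1)) → ℂ) :=
    LinearEquiv.ofFinrankEq _ _ (by simp [Module.finrank_pi_fintype, hN])
  exact ⟨towerCell ρ, isOpen_towerCell ρ, hρ, towerTrivialization ρ ε,
    isIsomorphism_towerTrivialization ρ ε, fun _ => rfl⟩

/-! ### Cokernels and the projection `π` -/

section Quotients

variable {K E F G H : Type*} [Field K] [AddCommGroup E] [Module K E] [AddCommGroup F] [Module K F]
  [AddCommGroup G] [Module K G] [AddCommGroup H] [Module K H]

theorem surjective_iff_finrank_ker_add [FiniteDimensional K F] [FiniteDimensional K G]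
    {p : F →ₗ[K] G} : Function.Surjective p ↔
      Module.finrank K (LinearMap.ker p) + Module.finrank K G = Module.finrank K F := by
  rw [← p.finrank_range_add_finrank_ker, add_comm, add_left_inj, ← LinearMap.range_eq_top]
  exact ⟨fun h => by rw [h, finrank_top], fun h => Submodule.eq_top_of_finrank_eq h.symm⟩

theorem exists_ker_eq [FiniteDimensional K F] [FiniteDimensional K G] {V : Submodule K F}
    (hV : Module.finrank K V + Module.finrank K G = Module.finrank K F) :
    ∃ p : F →ₗ[K] G, LinearMap.ker p = V := by
  have e : (F ⧸ V) ≃ₗ[K] G :=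
    LinearEquiv.ofFinrankEq _ _ (by have := V.finrank_quotient_add_finrank; lia)
  exact ⟨e.toLinearMap ∘ₗ V.mkQ, by rw [LinearEquiv.ker_comp, V.ker_mkQ]⟩

theorem exists_ker_prod_eq [FiniteDimensional K F] [FiniteDimensional K G] [FiniteDimensional K H]
    {P : F →ₗ[K] H} (hP : Function.Surjective P) {V : Submodule K F} (hVP : V ≤ LinearMap.ker P)
    (hV : Module.finrank K V + Module.finrank K G + Module.finrank K H = Module.finrank K F) :
    ∃ τ : F →ₗ[K] G, LinearMap.ker (τ.prod P) = V := by
  have hVP' := Submodule.map_comap_subtype (LinearMap.ker P) V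
  rw [inf_eq_right.2 hVP] at hVP'
  obtain ⟨τ', hτ'⟩ := exists_ker_eq (G := G) (V := V.comap (LinearMap.ker P).subtype) (by
    rw [(Submodule.comapSubtypeEquivOfLe hVP).finrank_eq]
    have := surjective_iff_finrank_ker_add.1 hP
    lia)
  obtain ⟨τ, hτ⟩ := LinearMap.exists_extend τ'
  refine ⟨τ, ?_⟩
  rw [← hVP', ← hτ', ← hτ, LinearMap.ker_comp, Submodule.map_comap_subtype, LinearMap.ker_prod,
    inf_comm]

theorem finrank_map_add_finrank_ker [FiniteDimensional K E] (p : E →ₗ[K] F) {V : Submodule K E}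
    (hV : LinearMap.ker p ≤ V) :
    Module.finrank K (V.map p) + Module.finrank K (LinearMap.ker p) = Module.finrank K V := by
  rw [← LinearMap.finrank_range_add_finrank_ker (p.domRestrict V), LinearMap.range_domRestrict,
    LinearMap.ker_domRestrict, (Submodule.comapSubtypeEquivOfLe hV).finrank_eq]

end Quotients

/-- The subspaces that contain the kernel of a surjective linear map, as subspaces of its
codomain. -/
def grQuotientEquiv {E F : Type*} [AddCommGroup E] [Module ℂ E] [FiniteDimensional ℂ E]
    [AddCommGroup F] [Module ℂ F] {p : E →ₗ[ℂ] F} (hp : Function.Surjective p) {d d' : ℕ}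
    (hd : d' + Module.finrank ℂ (LinearMap.ker p) = d) :
    {X : Gr d E // LinearMap.ker p ≤ X.1} ≃ Gr d' F where
  toFun X := ⟨X.1.1.map p, by
    have := finrank_map_add_finrank_ker p X.2
    have := X.1.2
    lia⟩
  invFun Y := ⟨⟨Y.1.comap p, by
    have := finrank_map_add_finrank_ker p (LinearMap.ker_le_comap (p := Y.1) p)
    rw [Submodule.map_comap_eq_of_surjective hp, Y.2] at this
    lia⟩, LinearMap.ker_le_comap p⟩
  left_inv X := Subtype.ext (Subtype.ext ((Submodule.comap_map_eq _ _).trans (sup_eq_left.2 X.2)))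
  right_inv Y := Subtype.ext (Submodule.map_comap_eq_of_surjective hp Y.1)

namespace SpaceWithFunctions

section ConstantRank

variable {X E F G : Type*} {S : SpaceWithFunctions X} [AddCommGroup E] [Module ℂ E]
  [FiniteDimensional ℂ E] [AddCommGroup F] [Module ℂ F] [FiniteDimensional ℂ F]
  [AddCommGroup G] [Module ℂ G] [FiniteDimensional ℂ G] {A : X → E →ₗ[ℂ] F}

omit [FiniteDimensional ℂ E] in
theorem IsRegularMap.mono {s t : Set X} (hst : s ⊆ t) {f : t → E}
    (hf : (S.sub t).IsRegularMap f) :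
    (S.sub s).IsRegularMap fun x => f (Set.inclusion hst x) :=
  hf.comp (isMorphism_sub_iff.2 (isMorphism_val s))

theorem exists_local_generalizedInverse (hA : S.IsRegularMap A) {k : ℕ}
    (hk : ∀ x, Module.finrank ℂ (LinearMap.range (A x)) = k) (x₀ : X) :
    ∃ U : Set X, IsOpen[S.toTopologicalSpace] U ∧ x₀ ∈ U ∧ ∃ g : U → F →ₗ[ℂ] E,
      (S.sub U).IsRegularMap g ∧ ∀ x : U, A x ∘ₗ g x ∘ₗ A x = A x := by
  obtain ⟨r, ρ, h₀⟩ := exists_comp_comp_eq_id_of_le_finrank_range (hk x₀).ge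
  have hAr := hA.hom_comp (isRegularMap_const r)
  have hB : S.IsRegularMap fun x => ρ ∘ₗ A x ∘ₗ r := (isRegularMap_const ρ).hom_comp hAr
  refine ⟨{x | IsUnit (ρ ∘ₗ A x ∘ₗ r)}, isOpen_isUnit hB, (congrArg IsUnit h₀).mpr isUnit_one,
    fun x => r ∘ₗ Ring.inverse (ρ ∘ₗ A x ∘ₗ r) ∘ₗ ρ, (isRegularMap_const r).hom_comp
      (((hB.restrict _).ringInverse fun x => x.2).hom_comp (isRegularMap_const ρ)), fun x => ?_⟩
  have hinv : Ring.inverse (ρ ∘ₗ A x ∘ₗ r) ∘ₗ (ρ ∘ₗ A x ∘ₗ r) = LinearMap.id :=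
    Ring.inverse_mul_cancel _ x.2
  have hinj : Function.Injective (A x.1 ∘ₗ r) :=
    LinearMap.injective_of_comp_eq_id _ (Ring.inverse (ρ ∘ₗ A x ∘ₗ r) ∘ₗ ρ) hinv
  have hrange : LinearMap.range (A x.1 ∘ₗ r) = LinearMap.range (A x.1) :=
    Submodule.eq_of_le_of_finrank_eq (LinearMap.range_comp_le_range _ _)
      (by rw [LinearMap.finrank_range_of_inj hinj, Module.finrank_fin_fun, hk])
  refine LinearMap.ext fun a => ?_
  obtain ⟨c, hc⟩ := hrange.ge ⟨a, rfl⟩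
  have := LinearMap.congr_fun hinv c
  simp only [LinearMap.comp_apply, LinearMap.id_apply] at this hc ⊢
  rw [← hc, this]

theorem exists_local_ker_eq_range (hA : S.IsRegularMap A) {k : ℕ}
    (hk : ∀ x, Module.finrank ℂ (LinearMap.range (A x)) = k) {p : X → F →ₗ[ℂ] G}
    (hp : S.IsRegularMap p) {x₀ : X} (hker : LinearMap.ker (p x₀) = LinearMap.range (A x₀))
    (hG : k + Module.finrank ℂ G = Module.finrank ℂ F) :
    ∃ U : Set X, IsOpen[S.toTopologicalSpace] U ∧ x₀ ∈ U ∧ ∃ g : U → F →ₗ[ℂ] E,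
      (S.sub U).IsRegularMap (fun x => p x ∘ₗ (LinearMap.id - A x ∘ₗ g x)) ∧
      ∀ x : U, LinearMap.ker (p x ∘ₗ (LinearMap.id - A x ∘ₗ g x)) = LinearMap.range (A x) := by
  obtain ⟨U, hU, hx₀, g, hg, hAg⟩ := exists_local_generalizedInverse hA hk x₀
  let q (x : U) : F →ₗ[ℂ] G := p x ∘ₗ (LinearMap.id - A x ∘ₗ g x)
  have hq : (S.sub U).IsRegularMap q := (hp.restrict U).hom_comp
    ((isRegularMap_const _).sub ((hA.restrict U).hom_comp hg))
  have hqx₀ : q ⟨x₀, hx₀⟩ = p x₀ := by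
    refine LinearMap.ext fun c => ?_
    have : p x₀ (A x₀ (g ⟨x₀, hx₀⟩ c)) = 0 := hker.ge ⟨_, rfl⟩
    simp [q, this]
  have hsurj : Function.Surjective (q ⟨x₀, hx₀⟩) := by
    rw [hqx₀, surjective_iff_finrank_ker_add, hker, hk, hG]
  have hrange (x : U) : LinearMap.range (A x) ≤ LinearMap.ker (q x) := by
    rintro _ ⟨a, rfl⟩
    have : A x (g x (A x a)) = A x a := LinearMap.congr_fun (hAg x) a
    simp [q, this]
  let V : Set U := {x | Function.Surjective (q x)}
  have hVU : Subtype.val '' V ⊆ U := Subtype.coe_image_subset U V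
  refine ⟨Subtype.val '' V, isOpen_image_val hU (isOpen_surjective hq), ⟨⟨x₀, hx₀⟩, hsurj, rfl⟩,
    fun x => g (Set.inclusion hVU x), hq.mono hVU, fun ⟨_, x, hx, hxy⟩ => ?_⟩
  subst hxy
  have := surjective_iff_finrank_ker_add.1 hx
  exact (Submodule.eq_of_le_of_finrank_eq (hrange x) (by rw [hk]; lia)).symm

end ConstantRank

end SpaceWithFunctions

section CokernelFrames

open SpaceWithFunctions

variable {I₀ I₁ : Type*} [Fintype I₁] {Ω : I₁ → I₀ → Type*} [∀ β α, Fintype (Ω β α)]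
  {u v w w' : I₀ ⊕ I₁ → ℕ}

theorem sourceMap_mem_range_sinkMap (e : RepSpace Ω w w') (β : I₁) (h : Σ α, Ω β α)
    (b : Fin (w (.inr β)) → ℂ) : (sourceMap e β b).2 h ∈ LinearMap.range (sinkMap e h.1) := by
  classical
  exact ⟨_, LinearMap.congr_fun (sinkMap_comp_inr_comp_single e h.1 ⟨β, h.2⟩) b⟩

variable [Fintype I₀]

theorem add_sinkDim (h : LDominant Ω u w w') (α : I₀) :
    u (.inl α) + sinkDim u w α = w (.inl α) :=
  Nat.add_sub_of_le (lDominant_iff.1 h (.inl α)).1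

theorem add_sourceDim (h : LDominant Ω u w w') (β : I₁) :
    u (.inr β) + sourceDim Ω u w' β = w' (.inr β) + ∑ h : (Σ α, Ω β α), u (.inl h.1) :=
  Nat.add_sub_of_le (lDominant_iff.1 h (.inr β)).2

theorem add_sourceDim_add_sum_sinkDim (h : LDominant Ω u w w') (β : I₁) :
    u (.inr β) + sourceDim Ω u w' β + ∑ h : (Σ α, Ω β α), sinkDim u w h.1 =
      w' (.inr β) + ∑ h : (Σ α, Ω β α), w (.inl h.1) := by
  rw [add_sourceDim h, add_assoc, ← Finset.sum_add_distrib]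
  simp only [add_sinkDim h]

theorem surjective_of_ker_eq_range_sinkMap (h : LDominant Ω u w w') {e : RepSpace Ω w w'}
    (he : e ∈ stratum Ω u w w') {α : I₀} {p : (Fin (w (.inl α)) → ℂ) →ₗ[ℂ]
      (Fin (sinkDim u w α) → ℂ)} (hp : LinearMap.ker p = LinearMap.range (sinkMap e α)) :
    Function.Surjective p := by
  have hrank : Module.finrank ℂ (LinearMap.ker p) = u (.inl α) := by
    rw [hp]
    exact he (.inl α)
  rw [surjective_iff_finrank_ker_add, hrank, Module.finrank_fin_fun, Module.finrank_fin_fun,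
    add_sinkDim h]

/-- Coordinates on the cokernels of the maps `A_i` of a representation in the stratum `E°_{u,w}`,
chosen compatibly along the arrows. -/
structure CokernelFrame (u : I₀ ⊕ I₁ → ℕ) (e : RepSpace Ω w w') where
  sink (α : I₀) : (Fin (w (.inl α)) → ℂ) →ₗ[ℂ] (Fin (sinkDim u w α) → ℂ)
  source (β : I₁) : (Fin (w' (.inr β)) → ℂ) × (∀ h : (Σ α, Ω β α), Fin (w (.inl h.1)) → ℂ) →ₗ[ℂ]
    (Fin (sourceDim Ω u w' β) → ℂ) × (∀ h : (Σ α, Ω β α), Fin (sinkDim u w h.1) → ℂ)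
  ker_sink (α : I₀) : LinearMap.ker (sink α) = LinearMap.range (sinkMap e α)
  ker_source (β : I₁) : LinearMap.ker (source β) = LinearMap.range (sourceMap e β)
  source_snd (β : I₁) (x) (h : Σ α, Ω β α) : (source β x).2 h = sink h.1 (x.2 h)

namespace CokernelFrame

variable {e : RepSpace Ω w w'} (φ : CokernelFrame u e) (he : e ∈ stratum Ω u w w')
include he

theorem finrank_ker_sink (α : I₀) : Module.finrank ℂ (LinearMap.ker (φ.sink α)) = u (.inl α) := by
  rw [φ.ker_sink]
  exact he (.inl α)

theorem finrank_ker_source (β : I₁) :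
    Module.finrank ℂ (LinearMap.ker (φ.source β)) = u (.inr β) := by
  rw [φ.ker_source]
  exact he (.inr β)

theorem surjective_sink (h : LDominant Ω u w w') (α : I₀) : Function.Surjective (φ.sink α) :=
  surjective_of_ker_eq_range_sinkMap h he (φ.ker_sink α)

theorem surjective_source (h : LDominant Ω u w w') (β : I₁) :
    Function.Surjective (φ.source β) := by
  rw [surjective_iff_finrank_ker_add, φ.finrank_ker_source he]
  simpa [Module.finrank_pi_fintype, add_assoc] using add_sourceDim_add_sum_sinkDim h β

/-- The subspaces `X_α` containing the image of `A_α` are the subspaces of its cokernel. -/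
def sinkEquiv (h : LDominant Ω u w w') (huv : u ≤ v) (α : I₀) :
    {X : Gr (v (.inl α)) (Fin (w (.inl α)) → ℂ) // LinearMap.ker (φ.sink α) ≤ X.1} ≃
      Gr ((v - u) (.inl α)) (Fin (sinkDim u w α) → ℂ) :=
  grQuotientEquiv (φ.surjective_sink he h α)
    (by rw [φ.finrank_ker_sink he]; exact Nat.sub_add_cancel (huv _))

/-- The subspaces `X_β` containing the image of `A_β` are the subspaces of its cokernel. -/
def sourceEquiv (h : LDominant Ω u w w') (huv : u ≤ v) (β : I₁) :
    {X : Gr (v (.inr β))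
        ((Fin (w' (.inr β)) → ℂ) × (∀ h : (Σ α, Ω β α), Fin (w (.inl h.1)) → ℂ)) //
      LinearMap.ker (φ.source β) ≤ X.1} ≃
      Gr ((v - u) (.inr β))
        ((Fin (sourceDim Ω u w' β) → ℂ) × (∀ h : (Σ α, Ω β α), Fin (sinkDim u w h.1) → ℂ)) :=
  grQuotientEquiv (φ.surjective_source he h β)
    (by rw [φ.finrank_ker_source he]; exact Nat.sub_add_cancel (huv _))

/-- Dividing out the images of the maps `A_i` identifies the fiber of `π` with the variety `M`. -/
def fiberEquiv (h : LDominant Ω u w w') (huv : u ≤ v) :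
    {X : GrProduct Ω v (w ∘ .inl) (w' ∘ .inr) // (e, X) ∈ nonsingularQuiverVariety Ω v w w'} ≃
      fiberVariety Ω u v w w' where
  toFun X :=
    ⟨(fun α => φ.sinkEquiv he h huv α ⟨X.1.1 α, (φ.ker_sink α).trans_le (X.2.2.1 α)⟩,
      fun β => φ.sourceEquiv he h huv β ⟨X.1.2 β, (φ.ker_source β).trans_le (X.2.2.2 β)⟩), by
      rintro β _ ⟨x, hx, rfl⟩
      exact ⟨trivial, fun h _ => ⟨x.2 h, (X.2.1 β hx).2 h trivial, (φ.source_snd β x h).symm⟩⟩⟩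
  invFun Y :=
    ⟨(fun α => ((φ.sinkEquiv he h huv α).symm (Y.1.1 α)).1,
      fun β => ((φ.sourceEquiv he h huv β).symm (Y.1.2 β)).1),
      fun β x hx => ⟨trivial, fun h _ => by
        have : (φ.source β x).2 h ∈ (Y.1.1 h.1).1 := (Y.2 β hx).2 h trivial
        rwa [φ.source_snd] at this⟩,
      fun α => (φ.ker_sink α).ge.trans ((φ.sinkEquiv he h huv α).symm (Y.1.1 α)).2,
      fun β => (φ.ker_source β).ge.trans ((φ.sourceEquiv he h huv β).symm (Y.1.2 β)).2⟩
  left_inv X := Subtype.ext (Prod.ext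
    (funext fun α => congrArg Subtype.val ((φ.sinkEquiv he h huv α).symm_apply_apply
      ⟨X.1.1 α, (φ.ker_sink α).trans_le (X.2.2.1 α)⟩))
    (funext fun β => congrArg Subtype.val ((φ.sourceEquiv he h huv β).symm_apply_apply
      ⟨X.1.2 β, (φ.ker_source β).trans_le (X.2.2.2 β)⟩)))
  right_inv Y := Subtype.ext (Prod.ext
    (funext fun α => (φ.sinkEquiv he h huv α).apply_symm_apply (Y.1.1 α))
    (funext fun β => (φ.sourceEquiv he h huv β).apply_symm_apply (Y.1.2 β)))

end CokernelFrame

variable {X : Type*} {S : SpaceWithFunctions X} {e : X → RepSpace Ω w w'}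

theorem exists_local_sinkCokernel (he : S.IsRegularMap e) (hu : ∀ x, e x ∈ stratum Ω u w w')
    (h : LDominant Ω u w w') (x₀ : X) (α : I₀) :
    ∃ U : Set X, IsOpen[S.toTopologicalSpace] U ∧ x₀ ∈ U ∧
      ∃ p : U → (Fin (w (.inl α)) → ℂ) →ₗ[ℂ] (Fin (sinkDim u w α) → ℂ),
        (S.sub U).IsRegularMap p ∧
        ∀ x : U, LinearMap.ker (p x) = LinearMap.range (sinkMap (e x) α) := by
  have hrank (x) : Module.finrank ℂ (LinearMap.range (sinkMap (e x) α)) = u (.inl α) :=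
    hu x (.inl α)
  have hdim : u (.inl α) + Module.finrank ℂ (Fin (sinkDim u w α) → ℂ) =
      Module.finrank ℂ (Fin (w (.inl α)) → ℂ) := by
    rw [Module.finrank_fin_fun, Module.finrank_fin_fun, add_sinkDim h]
  obtain ⟨p, hp⟩ := exists_ker_eq ((congrArg (· + _) (hrank x₀)).trans hdim)
  obtain ⟨U, hU, hx₀, g, hg, hker⟩ := exists_local_ker_eq_range (IsRegularMap.sinkMap he α) hrank
    (isRegularMap_const p) hp hdim
  exact ⟨U, hU, hx₀, _, hg, hker⟩

theorem exists_local_sourceCokernel (he : S.IsRegularMap e) (hu : ∀ x, e x ∈ stratum Ω u w w')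
    (hdom : LDominant Ω u w w')
    {σ : ∀ α : I₀, X → (Fin (w (.inl α)) → ℂ) →ₗ[ℂ] (Fin (sinkDim u w α) → ℂ)}
    (hσ : ∀ α, S.IsRegularMap (σ α))
    (hσker : ∀ x α, LinearMap.ker (σ α x) = LinearMap.range (sinkMap (e x) α)) (x₀ : X) (β : I₁) :
    ∃ U : Set X, IsOpen[S.toTopologicalSpace] U ∧ x₀ ∈ U ∧
      ∃ p : U → (Fin (w' (.inr β)) → ℂ) × (∀ h : (Σ α, Ω β α), Fin (w (.inl h.1)) → ℂ) →ₗ[ℂ]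
        (Fin (sourceDim Ω u w' β) → ℂ) × (∀ h : (Σ α, Ω β α), Fin (sinkDim u w h.1) → ℂ),
        (S.sub U).IsRegularMap p ∧
        ∀ x : U, LinearMap.ker (p x) = LinearMap.range (sourceMap (e x) β) ∧
          ∀ c h, (p x c).2 h = σ h.1 x (c.2 h) := by
  have hrank (x) : Module.finrank ℂ (LinearMap.range (sourceMap (e x) β)) = u (.inr β) :=
    hu x (.inr β)
  let P (x : X) : (Fin (w' (.inr β)) → ℂ) × (∀ h : (Σ α, Ω β α), Fin (w (.inl h.1)) → ℂ) →ₗ[ℂ]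
      (∀ h : (Σ α, Ω β α), Fin (sinkDim u w h.1) → ℂ) :=
    LinearMap.pi fun h => σ h.1 x ∘ₗ LinearMap.proj h ∘ₗ LinearMap.snd ℂ _ _
  have hP : S.IsRegularMap P := IsRegularMap.hom_pi fun h =>
    (hσ h.1).hom_comp (isRegularMap_const _)
  have hPA (x b) : P x (sourceMap (e x) β b) = 0 :=
    funext fun h => (hσker x h.1).ge (sourceMap_mem_range_sinkMap (e x) β h b)
  have hPsurj : Function.Surjective (P x₀) := fun c => by
    choose d hd using fun h : (Σ α, Ω β α) =>
      surjective_of_ker_eq_range_sinkMap hdom (hu x₀) (hσker x₀ h.1) (c h)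
    exact ⟨(0, d), funext hd⟩
  obtain ⟨τ, hτ⟩ := exists_ker_prod_eq (G := Fin (sourceDim Ω u w' β) → ℂ) hPsurj
    (V := LinearMap.range (sourceMap (e x₀) β)) (by rintro _ ⟨b, rfl⟩; exact hPA x₀ b) (by
      simpa [hrank, Module.finrank_pi_fintype] using add_sourceDim_add_sum_sinkDim hdom β)
  obtain ⟨U, hU, hx₀, g, hg, hker⟩ := exists_local_ker_eq_range (IsRegularMap.sourceMap he β) hrank
    ((isRegularMap_const τ).hom_prod hP) hτ (by
      simpa [Module.finrank_pi_fintype, add_assoc] using add_sourceDim_add_sum_sinkDim hdom β)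
  refine ⟨U, hU, hx₀, _, hg, fun x => ⟨hker x, fun c h => ?_⟩⟩
  have : σ h.1 x ((sourceMap (e x) β (g x c)).2 h) = 0 := congrFun (hPA x (g x c)) h
  simp [P, this]

theorem exists_local_cokernelFrame (he : S.IsRegularMap e) (hu : ∀ x, e x ∈ stratum Ω u w w')
    (h : LDominant Ω u w w') (x₀ : X) :
    ∃ U : Set X, IsOpen[S.toTopologicalSpace] U ∧ x₀ ∈ U ∧
      ∃ φ : ∀ x : U, CokernelFrame u (e x),
        (∀ α, (S.sub U).IsRegularMap fun x => (φ x).sink α) ∧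
        ∀ β, (S.sub U).IsRegularMap fun x => (φ x).source β := by
  let _ := S.toTopologicalSpace
  choose U₀ hU₀ hx₀ σ hσ hσker using exists_local_sinkCokernel he hu h x₀
  let U : Set X := ⋂ α, U₀ α
  have hU : IsOpen U := isOpen_iInter_of_finite hU₀
  have hUx₀ : x₀ ∈ U := Set.mem_iInter.2 hx₀
  have hUU₀ (α) : U ⊆ U₀ α := Set.iInter_subset U₀ α
  have hσU (α) := (hσ α).mono (hUU₀ α)
  choose U₁ hU₁ hx₁ τ hτ hτker using exists_local_sourceCokernel (he.restrict U) (fun x => hu x) h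
    hσU (fun x α => hσker α _) ⟨x₀, hUx₀⟩
  let V : Set U := ⋂ β, U₁ β
  have hV : IsOpen[(S.sub U).toTopologicalSpace] V :=
    let _ := (S.sub U).toTopologicalSpace
    isOpen_iInter_of_finite hU₁
  have hVU : Subtype.val '' V ⊆ U := Subtype.coe_image_subset U V
  let ι : Subtype.val '' V → U := Set.inclusion hVU
  have hι (x) (β) : ι x ∈ U₁ β := by
    obtain ⟨_, x, hx, rfl⟩ := x
    exact Set.mem_iInter.1 hx β
  refine ⟨Subtype.val '' V, isOpen_image_val hU hV, ⟨⟨x₀, hUx₀⟩, Set.mem_iInter.2 hx₁, rfl⟩,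
    fun x =>
      { sink α := σ α (Set.inclusion (hUU₀ α) (ι x))
        source β := τ β ⟨ι x, hι x β⟩
        ker_sink α := hσker α _
        ker_source β := (hτker β _).1
        source_snd β := (hτker β _).2 },
    fun α => (hσU α).mono hVU, fun β => ?_⟩
  exact (hτ β).comp (isMorphism_sub_iff.2 (isMorphism_sub_iff.2 (isMorphism_val _)))

end CokernelFrames

section Trivialization

open SpaceWithFunctions

variable {I₀ I₁ : Type*} [Fintype I₀] [Fintype I₁] {Ω : I₁ → I₀ → Type*}
  [∀ β α, Fintype (Ω β α)] {u v w w' : I₀ ⊕ I₁ → ℕ}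

/-- The trivialization of `π` over a set of points of the stratum `E°_{u,w}` carrying
cokernel frames. -/
def quiverTrivialization (h : LDominant Ω u w w') (huv : u ≤ v) {U : Set (stratumIn Ω u v w w')}
    (φ : ∀ y : U, CokernelFrame u y.1.1.1) :
    (stratumIn Ω u v w w').restrictPreimage (quiverProj Ω v w w') ⁻¹' U ≃
      U × fiberVariety Ω u v w w' where
  toFun x := (⟨_, x.2⟩, (φ ⟨_, x.2⟩).fiberEquiv x.1.2 h huv ⟨x.1.1.1.2, x.1.1.2⟩)
  invFun q := ⟨⟨⟨(_, (((φ q.1).fiberEquiv q.1.1.2 h huv).symm q.2).1),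
    (((φ q.1).fiberEquiv q.1.1.2 h huv).symm q.2).2⟩, q.1.1.2⟩, q.1.2⟩
  left_inv x := Subtype.ext (Subtype.ext (Subtype.ext (Prod.ext rfl (congrArg Subtype.val
    (((φ ⟨_, x.2⟩).fiberEquiv x.1.2 h huv).symm_apply_apply ⟨x.1.1.1.2, x.1.1.2⟩)))))
  right_inv q := Prod.ext rfl (((φ q.1).fiberEquiv q.1.1.2 h huv).apply_symm_apply q.2)

theorem isIsomorphism_quiverTrivialization (h : LDominant Ω u w w') (huv : u ≤ v)
    {U : Set (stratumIn Ω u v w w')} {φ : ∀ y : U, CokernelFrame u y.1.1.1}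
    (hsink : ∀ α, (((affineQuiverSpace Ω v w w').sub (stratumIn Ω u v w w')).sub U).IsRegularMap
      fun y => (φ y).sink α)
    (hsource : ∀ β, (((affineQuiverSpace Ω v w w').sub (stratumIn Ω u v w w')).sub U).IsRegularMap
      fun y => (φ y).source β) :
    IsIsomorphism
      (((nonsingularQuiverSpace Ω v w w').sub
          (quiverProj Ω v w w' ⁻¹' stratumIn Ω u v w w')).sub
        ((stratumIn Ω u v w w').restrictPreimage (quiverProj Ω v w w') ⁻¹' U))
      ((((affineQuiverSpace Ω v w w').sub (stratumIn Ω u v w w')).sub U).prod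
        (fiberSpace Ω u v w w'))
      (quiverTrivialization h huv φ) := by
  constructor
  · have ⟨hrep, hX⟩ := isMorphism_prod_iff.1
      ((isMorphism_val (nonsingularQuiverVariety Ω v w w')).comp
        ((isMorphism_val (S := nonsingularQuiverSpace Ω v w w')
          (quiverProj Ω v w w' ⁻¹' stratumIn Ω u v w w')).comp
        (isMorphism_val
          ((stratumIn Ω u v w w').restrictPreimage (quiverProj Ω v w w') ⁻¹' U))))
    have ⟨hX₀, hX₁⟩ := isMorphism_prod_iff.1 hX
    have hbase : IsMorphism _ (((affineQuiverSpace Ω v w w').sub (stratumIn Ω u v w w')).sub U)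
        fun x => (quiverTrivialization h huv φ x).1 :=
      isMorphism_sub_iff.2 (isMorphism_sub_iff.2 (isMorphism_sub_iff.2 hrep))
    refine isMorphism_prod_iff.2 ⟨hbase, isMorphism_sub_iff.2 (isMorphism_prod_iff.2
      ⟨isMorphism_pi_iff.2 fun α => ?_, isMorphism_pi_iff.2 fun β => ?_⟩)⟩
    · exact isMorphism_grassmannian_map (isMorphism_pi_iff.1 hX₀ α) ((hsink α).comp hbase)
        fun _ => rfl
    · exact isMorphism_grassmannian_map (isMorphism_pi_iff.1 hX₁ β) ((hsource β).comp hbase)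
        fun _ => rfl
  · have hrep := (isMorphism_val (affineQuiverVariety Ω v w w')).comp
      ((isMorphism_val (S := affineQuiverSpace Ω v w w') (stratumIn Ω u v w w')).comp
      ((isMorphism_val U).comp (isMorphism_fst (T := fiberSpace Ω u v w w'))))
    have ⟨hY₀, hY₁⟩ := isMorphism_prod_iff.1
      ((isMorphism_val (S := grProductSpace Ω (v - u) (sinkDim u w) (sourceDim Ω u w'))
        (fiberVariety Ω u v w w')).comp
        (isMorphism_snd (S := ((affineQuiverSpace Ω v w w').sub (stratumIn Ω u v w w')).sub U)))
    refine isMorphism_sub_iff.2 (isMorphism_sub_iff.2 (isMorphism_sub_iff.2 (isMorphism_prod_iff.2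
      ⟨hrep, isMorphism_prod_iff.2
        ⟨isMorphism_pi_iff.2 fun α => ?_, isMorphism_pi_iff.2 fun β => ?_⟩⟩)))
    · exact isMorphism_grassmannian_comap (isMorphism_pi_iff.1 hY₀ α)
        ((hsink α).comp isMorphism_fst) (fun q => (φ q.1).surjective_sink q.1.1.2 h α)
        fun _ => rfl
    · exact isMorphism_grassmannian_comap (isMorphism_pi_iff.1 hY₁ β)
        ((hsource β).comp isMorphism_fst) (fun q => (φ q.1).surjective_source q.1.1.2 h β)
        fun _ => rfl

theorem isLocallyTrivialBundle_quiverProj (huv : u ≤ v) (h : LDominant Ω u w w') :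
    IsLocallyTrivialBundle
      ((nonsingularQuiverSpace Ω v w w').sub (quiverProj Ω v w w' ⁻¹' stratumIn Ω u v w w'))
      ((affineQuiverSpace Ω v w w').sub (stratumIn Ω u v w w'))
      (fiberSpace Ω u v w w')
      ((stratumIn Ω u v w w').restrictPreimage (quiverProj Ω v w w')) := by
  intro y₀
  have he : ((affineQuiverSpace Ω v w w').sub (stratumIn Ω u v w w')).IsRegularMap
      fun y => y.1.1 := (isRegularMap_id (E := RepSpace Ω w w')).restrict _ |>.restrict _
  obtain ⟨U, hU, hy₀, φ, hsink, hsource⟩ := exists_local_cokernelFrame he (fun y => y.2) h y₀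
  exact ⟨U, hU, hy₀, quiverTrivialization h huv φ,
    isIsomorphism_quiverTrivialization h huv hsink hsource, fun _ => rfl⟩

theorem add_sum_sub_eq_sourceDim_add (huv : u ≤ v) (h : LDominant Ω u w w') (β : I₁) :
    w' (.inr β) + (∑ h : (Σ α, Ω β α), v (.inl h.1)) - u (.inr β) =
      sourceDim Ω u w' β + ∑ h : (Σ α, Ω β α), (v - u) (.inl h.1) := by
  have hsum : ∑ h : (Σ α, Ω β α), v (.inl h.1) =
      ∑ h : (Σ α, Ω β α), u (.inl h.1) + ∑ h : (Σ α, Ω β α), (v - u) (.inl h.1) := by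
    rw [← Finset.sum_add_distrib]
    exact Finset.sum_congr rfl fun h _ => (Nat.add_sub_of_le (huv (.inl h.1))).symm
  have := add_sourceDim h β
  lia

end Trivialization

theorem lemma3p5 {I₀ I₁ : Type*} [Fintype I₀] [Fintype I₁]
    (Ω : I₁ → I₀ → Type*) [∀ β α, Fintype (Ω β α)] (v w w' : I₀ ⊕ I₁ → ℕ) :
    -- (a) the strata
    (∀ u, u ≤ v →
      ((stratum Ω u w w').Nonempty ↔ LDominant Ω u w w') ∧
      (LDominant Ω u w w' →
        ((repSpace Ω w w').sub (stratum Ω u w w')).IsNonsingular ∧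
        @IsLocallyClosed _ (repSpace Ω w w').toTopologicalSpace (stratum Ω u w w') ∧
        @IsLocallyClosed _ (affineQuiverSpace Ω v w w').toTopologicalSpace
          (stratumIn Ω u v w w') ∧
        ((repSpace Ω w w').sub (stratum Ω u w w')).IsIrred ∧
        ((repSpace Ω w w').sub (stratum Ω u w w')).IsRational)) ∧
    -- (a) the stratification of `E_{v,w}`
    affineQuiverVariety Ω v w w' =
      (⋃ u ∈ {u : I₀ ⊕ I₁ → ℕ | u ≤ v ∧ LDominant Ω u w w'}, stratum Ω u w w') ∧
    (affineQuiverSpace Ω v w w').IsStratification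
      (fun u : {u : I₀ ⊕ I₁ → ℕ // u ≤ v ∧ LDominant Ω u w w'} => stratumIn Ω u.1 v w w') ∧
    -- (b) the restriction of `π` to a stratum, and the structure of its fiber
    (∀ u, u ≤ v → LDominant Ω u w w' →
      SpaceWithFunctions.IsLocallyTrivialBundle
        ((nonsingularQuiverSpace Ω v w w').sub (quiverProj Ω v w w' ⁻¹' stratumIn Ω u v w w'))
        ((affineQuiverSpace Ω v w w').sub (stratumIn Ω u v w w'))
        (fiberSpace Ω u v w w')
        ((stratumIn Ω u v w w').restrictPreimage (quiverProj Ω v w w')) ∧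
      SpaceWithFunctions.IsLocallyTrivialBundle
        (fiberSpace Ω u v w w')
        (SpaceWithFunctions.pi fun α : I₀ =>
          grassmannian (v (.inl α) - u (.inl α)) (Fin (w (.inl α) - u (.inl α)) → ℂ))
        (SpaceWithFunctions.pi fun β : I₁ =>
          grassmannian (v (.inr β) - u (.inr β))
            (Fin (w' (.inr β) + (∑ h : (Σ α, Ω β α), v (.inl h.1)) - u (.inr β)) → ℂ))
        (towerProj Ω (v - u) (sinkDim u w) (sourceDim Ω u w'))) ∧
    -- (b) the variety `F_{v,w}`
    SpaceWithFunctions.IsLocallyTrivialBundle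
      (flagSpace Ω v w w')
      (SpaceWithFunctions.pi fun α : I₀ => grassmannian (v (.inl α)) (Fin (w (.inl α)) → ℂ))
      (SpaceWithFunctions.pi fun β : I₁ =>
        grassmannian (v (.inr β))
          (Fin (w' (.inr β) + ∑ h : (Σ α, Ω β α), v (.inl h.1)) → ℂ))
      (towerProj Ω v (w ∘ .inl) (w' ∘ .inr)) := by
  refine ⟨fun u huv => ⟨stratum_nonempty_iff, fun h => ⟨isNonsingular_stratum Ω u w w',
      isLocallyClosed_vertexRank_eq SpaceWithFunctions.isRegularMap_id u,
      isStratification_stratumIn.isLocallyClosed ⟨u, huv, h⟩, isIrred_stratum h,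
      isRational_stratum h⟩⟩,
    affineQuiverVariety_eq_biUnion_stratum, isStratification_stratumIn,
    fun u huv h => ⟨isLocallyTrivialBundle_quiverProj huv h, ?_⟩, ?_⟩
  · exact isLocallyTrivialBundle_towerProj (v - u) (sinkDim u w)
      (add_sum_sub_eq_sourceDim_add huv h)
  · exact isLocallyTrivialBundle_towerProj v (w ∘ .inl) fun _ => rfl
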